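/- Let $A$ be a $\sigma$-unital, trivially graded Real $C^*$-algebra, i.e. a complex $C^*$-algebra with an antilinear involutive $*$-automorphism $a\mapsto a^{\mathfrak r}$; the Real structure extends to the multiplier algebra $\mathrm{Mult}(A)$ by $m^{\mathfrak r}a=(m\,a^{\mathfrak r})^{\mathfrak r}$. Let $J_0,J_1\in\mathrm{Mult}(A)$ be Real skew-adjoint unitaries ($J_k^{\mathfrak r}=J_k$, $J_k^*=-J_k$, $J_k^*J_k=J_kJ_k^*=1$) with $J_1-J_0\in A$. Let $X=\overline{(J_1-J_0)A}$, a closed right ideal of $A$ and hence a Real Hilbert $A$-module with inner product $(x\mid y)=x^*y$. The operators $J_0$, $J_1+J_0$ and $J_1-J_0$ preserve $X$, and $J_1-J_0$ is injective on $X$ with dense range. The Cayley transform is the unbounded operator on $X$ $$\mathcal C_{J_0}(J_1)=J_0(J_1+J_0)(J_1-J_0)^{-1},\qquad \mathrm{Dom}\,\mathcal C_{J_0}(J_1)=(J_1-J_0)X .$$ On $X\otimes\bigwedge^*\mathbb C=X\oplus X$ (first summand even, second summand odd) put $\gamma=\begin{pmatrix}0&1\\1&0\end{pmatrix}$, $\rho=\begin{pmatrix}0&-1\\1&0\end{pmatrix}$,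 and let $F=D(1+D^2)^{-1/2}$ be the bounded transform of $D=\mathcal C_{J_0}(J_1)\otimes\rho$. Let $C\ell_{2,0}$ be the Real graded $C^*$-algebra generated by two anti-commuting odd Real self-adjoint unitaries, acting on $X\otimes\bigwedge^*\mathbb C$ by sending the generators to $1\otimes\gamma$ and $J_0\otimes\rho$. Then $\big(C\ell_{2,0},\,X\otimes\bigwedge^*\mathbb C,\,F\big)$ is a Real Kasparov $C\ell_{2,0}$-$A$-module; denote its class by $[\mathcal C_{J_0}(J_1)]\in KKR(C\ell_{2,0},A)$, where $KKR(C\ell_{2,0},A)$ consists of Real Kasparov modules modulo homotopy (including unitary equivalence), with neutral element $0$ the class of the zero module. (i) Let $J:[0,1]\to\mathrm{Mult}(A)$, $t\mapsto J_t$, be norm-continuous, with every $J_t$ a Real skew-adjoint unitary and $J_t-J_0\in A$ for all $t\in[0,1]$. Then $[\mathcal C_{J_0}(J_1)]=0$ in $KKR(C\ell_{2,0},A)$. (ii) Equivalently: if $J_0,J_1\in\mathrm{Mult}(A)$ are Real skew-adjoint unitaries with $J_1-J_0\in A$ and $[\mathcal C_{J_0}(J_1)]\neq0$ in $KKR(C\ell_{2,0},A)$,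 then there is no norm-continuous path $(J_t)_{t\in[0,1]}$ of Real skew-adjoint unitaries in $\mathrm{Mult}(A)$ from $J_0$ to $J_1$ with $J_t-J_0\in A$ for all $t\in[0,1]$. -/

import Mathlib

open scoped MultiplierAlgebra unitInterval
open Filter Topology

universe u v

/-! ### Graded Real C*-algebras -/

/-- A Real structure (an antilinear involutive `*`-automorphism `conj`) together with a
`ℤ/2`-grading on a complex C*-algebra.  The grading is encoded by its grading automorphism, which
is `1` on the even part and `-1` on the odd part. -/
class GradedRealCStarAlgebra (A : Type u) [NonUnitalCStarAlgebra A] where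
  conj : A → A
  conj_add : ∀ a b, conj (a + b) = conj a + conj b
  conj_smul : ∀ (z : ℂ) (a : A), conj (z • a) = star z • conj a
  conj_mul : ∀ a b, conj (a * b) = conj a * conj b
  conj_star : ∀ a, conj (star a) = star (conj a)
  conj_conj : ∀ a, conj (conj a) = a
  parity : A →⋆ₙₐ[ℂ] A
  parity_parity : ∀ a, parity (parity a) = a
  parity_conj : ∀ a, parity (conj a) = conj (parity a)

namespace GradedRealCStarAlgebra

section basic

variable {A : Type u} [NonUnitalCStarAlgebra A] [GradedRealCStarAlgebra A]

/-- `a ↦ (conj a)*` as a complex-linear `*`-homomorphism into the opposite algebra. -/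
def conjOp (A : Type u) [NonUnitalCStarAlgebra A] [GradedRealCStarAlgebra A] :
    A →⋆ₙₐ[ℂ] Aᵐᵒᵖ where
  toFun a := MulOpposite.op (star (conj a))
  map_smul' z a := by simp [conj_smul]
  map_zero' := by
    have := conj_smul (A := A) 0 0
    simp only [zero_smul, star_zero] at this
    simp [this]
  map_add' a b := by simp [conj_add]
  map_mul' a b := by simp [conj_mul]
  map_star' a := by simp [conj_star]

lemma norm_conj (a : A) : ‖conj a‖ = ‖a‖ := by
  have h : Function.Injective (conjOp A) := by
    intro a b hab
    have h1 : star (conj a) = star (conj b) := MulOpposite.op_injective hab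
    have h2 := star_injective h1
    rw [← conj_conj a, h2, conj_conj]
  have := NonUnitalStarAlgHom.norm_map (conjOp A) h a
  rw [← this]
  change _ = ‖star (conj a)‖
  rw [norm_star]

/-- The real structure as an antilinear isometry. -/
def conjₗᵢ (A : Type u) [NonUnitalCStarAlgebra A] [GradedRealCStarAlgebra A] :
    A →ₗᵢ⋆[ℂ] A where
  toFun := conj
  map_add' := conj_add
  map_smul' := conj_smul
  norm_map' := norm_conj

lemma continuous_conj : Continuous (conj : A → A) := (conjₗᵢ A).continuous

lemma conj_zero : conj (0 : A) = 0 := (conjₗᵢ A).map_zero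

lemma conj_neg (a : A) : conj (-a) = -conj a := (conjₗᵢ A).map_neg a

lemma continuous_parity : Continuous (parity : A → A) :=
  AddMonoidHomClass.continuous_of_bound (parity : A →⋆ₙₐ[ℂ] A) 1 fun a => by
    simpa using NonUnitalStarAlgHom.norm_apply_le (parity : A →⋆ₙₐ[ℂ] A) a

end basic

/-- `C([0,1], B)` with the pointwise Real structure and grading. -/
noncomputable instance instPath (B : Type u) [NonUnitalCStarAlgebra B]
    [GradedRealCStarAlgebra B] : GradedRealCStarAlgebra C(I, B) where
  conj f := ⟨fun t => conj (f t), continuous_conj.comp f.continuous⟩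
  conj_add f g := by ext t; simp [conj_add]
  conj_smul z f := by ext t; simp [conj_smul]
  conj_mul f g := by ext t; simp [conj_mul]
  conj_star f := by ext t; simp [conj_star]
  conj_conj f := by ext t; simp [conj_conj]
  parity :=
    { toFun := fun f => ⟨fun t => parity (f t), continuous_parity.comp f.continuous⟩
      map_smul' := fun z f => by ext t; simp
      map_zero' := by ext t; simp
      map_add' := fun f g => by ext t; simp
      map_mul' := fun f g => by ext t; simp
      map_star' := fun f => by ext t; simp [map_star] }
  parity_parity f := by ext t; simp [parity_parity]
  parity_conj f := by ext t; simp [parity_conj]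

/-- The grading is trivial: every element is even. -/
def TriviallyGraded (A : Type u) [NonUnitalCStarAlgebra A] [GradedRealCStarAlgebra A] : Prop :=
  ∀ a : A, parity a = a

end GradedRealCStarAlgebra

open GradedRealCStarAlgebra

/-- A C*-algebra is `σ`-unital if it has a countable (sequential) approximate unit. -/
def SigmaUnital (A : Type u) [NonUnitalCStarAlgebra A] : Prop :=
  ∃ e : ℕ → A, (map e atTop).IsApproximateUnit

/-! ### Real graded Hilbert C*-modules (right modules) -/

/-- A Real `ℤ/2`-graded right Hilbert `B`-module.  `rsmul x b` is `x · b`, the inner product is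
antilinear in the first variable, and completeness refers to the norm `‖x‖² = ‖(x ∣ x)‖`. -/
structure RealHilbertModule (B : Type u) [NonUnitalCStarAlgebra B]
    [GradedRealCStarAlgebra B] where
  carrier : Type u
  [addCommGroup : AddCommGroup carrier]
  [module : Module ℂ carrier]
  rsmul : carrier → B → carrier
  add_rsmul : ∀ x y b, rsmul (x + y) b = rsmul x b + rsmul y b
  rsmul_add : ∀ x b c, rsmul x (b + c) = rsmul x b + rsmul x c
  rsmul_mul : ∀ x b c, rsmul x (b * c) = rsmul (rsmul x b) c
  smul_rsmul : ∀ (z : ℂ) x b, rsmul (z • x) b = z • rsmul x b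
  rsmul_smul : ∀ (z : ℂ) x b, rsmul x (z • b) = z • rsmul x b
  inner : carrier → carrier → B
  inner_add_right : ∀ x y z, inner x (y + z) = inner x y + inner x z
  inner_smul_right : ∀ (c : ℂ) x y, inner x (c • y) = c • inner x y
  inner_rsmul_right : ∀ x y b, inner x (rsmul y b) = inner x y * b
  star_inner : ∀ x y, star (inner x y) = inner y x
  inner_self_nonneg : ∀ x, ∃ b, inner x x = star b * b
  inner_self_eq_zero : ∀ x, inner x x = 0 → x = 0
  complete : ∀ s : ℕ → carrier,
    Tendsto (fun p : ℕ × ℕ => ‖inner (s p.1 - s p.2) (s p.1 - s p.2)‖) atTop (𝓝 0) →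
    ∃ x, Tendsto (fun n => ‖inner (s n - x) (s n - x)‖) atTop (𝓝 0)
  conj : carrier → carrier
  conj_add : ∀ x y, conj (x + y) = conj x + conj y
  conj_smul : ∀ (z : ℂ) x, conj (z • x) = star z • conj x
  conj_conj : ∀ x, conj (conj x) = x
  conj_rsmul : ∀ x b, conj (rsmul x b) = rsmul (conj x) (GradedRealCStarAlgebra.conj b)
  inner_conj : ∀ x y, inner (conj x) (conj y) = GradedRealCStarAlgebra.conj (inner x y)
  parity : carrier →ₗ[ℂ] carrier
  parity_parity : ∀ x, parity (parity x) = x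
  parity_rsmul : ∀ x b, parity (rsmul x b) = rsmul (parity x) (GradedRealCStarAlgebra.parity b)
  inner_parity : ∀ x y, inner (parity x) (parity y) = GradedRealCStarAlgebra.parity (inner x y)
  parity_conj : ∀ x, parity (conj x) = conj (parity x)

namespace RealHilbertModule

attribute [instance] RealHilbertModule.addCommGroup RealHilbertModule.module

section defs

variable {B : Type u} [NonUnitalCStarAlgebra B] [GradedRealCStarAlgebra B]
  (E : RealHilbertModule B)

/-- The module norm `‖x‖ = ‖(x ∣ x)‖^{1/2}`. -/
noncomputable def nrm (x : E.carrier) : ℝ := Real.sqrt ‖E.inner x x‖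

/-- The module is the closed span of `g₀ · B ∪ g₁ · B ∪ ⋯` for some sequence `g`. -/
def CountablyGenerated : Prop :=
  ∃ g : ℕ → E.carrier, ∀ x : E.carrier, ∀ ε > 0,
    ∃ y ∈ Submodule.span ℂ {z | ∃ n b, z = E.rsmul (g n) b}, E.nrm (x - y) < ε

/-- `T` is self-adjoint (in particular adjointable, hence bounded and `B`-linear). -/
def IsSelfAdj (T : Module.End ℂ E.carrier) : Prop :=
  ∀ x y, E.inner (T x) y = E.inner x (T y)

/-- `T` is positive. -/
def IsPos (T : Module.End ℂ E.carrier) : Prop :=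
  E.IsSelfAdj T ∧ ∀ x, ∃ b, E.inner (T x) x = star b * b

/-- `T` lies in `𝕂_B(E)`, the operator-norm closure of the finite sums of the rank-one operators
`z ↦ x · (y ∣ z)`. -/
def IsCompactEnd (T : Module.End ℂ E.carrier) : Prop :=
  ∀ ε > 0, ∃ (n : ℕ) (x y : Fin n → E.carrier),
    ∀ z, E.nrm (T z - ∑ i, E.rsmul (x i) (E.inner (y i) z)) ≤ ε * E.nrm z

/-- `R = (1 + D²)^{-1/2}`: `R` is positive, and `(1 + D²) R² = 1`. -/
def IsInvSqrtOnePlusSq (D : E.carrier →ₗ.[ℂ] E.carrier) (R : Module.End ℂ E.carrier) : Prop :=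
  E.IsPos R ∧ ∀ x, ∃ (h₁ : R (R x) ∈ D.domain) (h₂ : D ⟨R (R x), h₁⟩ ∈ D.domain),
    R (R x) + D ⟨D ⟨R (R x), h₁⟩, h₂⟩ = x

/-- `F = D (1 + D²)^{-1/2}`, the bounded transform of the (self-adjoint regular) operator `D`. -/
def IsBoundedTransform (D : E.carrier →ₗ.[ℂ] E.carrier) (F : Module.End ℂ E.carrier) : Prop :=
  ∃ R : Module.End ℂ E.carrier, E.IsInvSqrtOnePlusSq D R ∧
    ∀ x, ∃ h : R x ∈ D.domain, F x = D ⟨R x, h⟩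

end defs

/-- The zero Hilbert module. -/
def zero (B : Type u) [NonUnitalCStarAlgebra B] [GradedRealCStarAlgebra B] :
    RealHilbertModule B where
  carrier := PUnit
  rsmul _ _ := 0
  add_rsmul _ _ _ := rfl
  rsmul_add _ _ _ := rfl
  rsmul_mul _ _ _ := rfl
  smul_rsmul _ _ _ := rfl
  rsmul_smul _ _ _ := rfl
  inner _ _ := 0
  inner_add_right _ _ _ := by simp
  inner_smul_right _ _ _ := by simp
  inner_rsmul_right _ _ _ := by simp
  star_inner _ _ := by simp
  inner_self_nonneg _ := ⟨0, by simp⟩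
  inner_self_eq_zero _ _ := rfl
  complete _ _ := ⟨0, by simp⟩
  conj _ := 0
  conj_add _ _ := rfl
  conj_smul _ _ := rfl
  conj_conj _ := rfl
  conj_rsmul _ _ := rfl
  inner_conj _ _ := conj_zero.symm
  parity := 0
  parity_parity _ := rfl
  parity_rsmul _ _ := rfl
  inner_parity _ _ := by simp
  parity_conj _ := rfl

end RealHilbertModule

/-! ### Kasparov modules and `KKR` -/

/-- A Real Kasparov `A`-`B`-module `(A, π E_B, F)`, with `E` countably generated.  The graded
commutator of the odd operator `F` with `π a` is `F π(a) - π(parity a) F`. -/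
structure KasparovModule (A : Type v) (B : Type u) [NonUnitalCStarAlgebra A]
    [GradedRealCStarAlgebra A] [NonUnitalCStarAlgebra B] [GradedRealCStarAlgebra B] where
  E : RealHilbertModule B
  countablyGenerated : E.CountablyGenerated
  π : A →ₙₐ[ℂ] Module.End ℂ E.carrier
  inner_π : ∀ a x y, E.inner (π a x) y = E.inner x (π (star a) y)
  π_conj : ∀ a x, π (conj a) (E.conj x) = E.conj (π a x)
  π_parity : ∀ a x, π (parity a) (E.parity x) = E.parity (π a x)
  F : Module.End ℂ E.carrier
  F_selfAdj : E.IsSelfAdj F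
  F_conj : ∀ x, F (E.conj x) = E.conj (F x)
  F_odd : ∀ x, F (E.parity x) = -E.parity (F x)
  comm_compact : ∀ a, E.IsCompactEnd (F * π a - π (parity a) * F)
  sq_compact : ∀ a, E.IsCompactEnd (π a * (1 - F * F))

namespace KasparovModule

variable {A : Type v} {B : Type u} [NonUnitalCStarAlgebra A] [GradedRealCStarAlgebra A]
  [NonUnitalCStarAlgebra B] [GradedRealCStarAlgebra B]

/-- The zero Kasparov module. -/
def zero (A : Type v) (B : Type u) [NonUnitalCStarAlgebra A] [GradedRealCStarAlgebra A]
    [NonUnitalCStarAlgebra B] [GradedRealCStarAlgebra B] : KasparovModule A B where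
  E := RealHilbertModule.zero B
  countablyGenerated := ⟨fun _ => 0, fun _ ε hε => ⟨0, Submodule.zero_mem _, by
    simpa [RealHilbertModule.nrm, RealHilbertModule.zero] using hε⟩⟩
  π := 0
  inner_π _ _ _ := rfl
  π_conj _ _ := rfl
  π_parity _ _ := rfl
  F := 0
  F_selfAdj _ _ := rfl
  F_conj _ := rfl
  F_odd _ := rfl
  comm_compact _ ε _ := ⟨0, Fin.elim0, Fin.elim0, fun z => by
    simp [RealHilbertModule.nrm, RealHilbertModule.zero]⟩
  sq_compact _ ε _ := ⟨0, Fin.elim0, Fin.elim0, fun z => by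
    simp [RealHilbertModule.nrm, RealHilbertModule.zero]⟩

/-- `M` is unitarily equivalent to the push-forward `N ⊗_{ev_t} B` of the Kasparov
`A`-`C([0,1], B)`-module `N` along the evaluation `ev_t : C([0,1], B) → B`.  Since `ev_t` is
surjective, the module `E ⊗_{ev_t} B` is the quotient of `E` by `{x ∣ (x ∣ x)(t) = 0}`, so a
unitary equivalence with `M` is the same as a surjection `ψ` compatible with all the structure. -/
def IsEvaluation (t : I) (N : KasparovModule A C(I, B)) (M : KasparovModule A B) : Prop :=
  ∃ ψ : N.E.carrier →ₗ[ℂ] M.E.carrier, Function.Surjective ψ ∧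
    (∀ x y, M.E.inner (ψ x) (ψ y) = N.E.inner x y t) ∧
    (∀ x f, ψ (N.E.rsmul x f) = M.E.rsmul (ψ x) (f t)) ∧
    (∀ x, ψ (N.E.conj x) = M.E.conj (ψ x)) ∧
    (∀ x, ψ (N.E.parity x) = M.E.parity (ψ x)) ∧
    (∀ a x, ψ (N.π a x) = M.π a (ψ x)) ∧
    (∀ x, ψ (N.F x) = M.F (ψ x))

/-- Homotopy of Real Kasparov modules. -/
def Homotopic (M₀ M₁ : KasparovModule A B) : Prop :=
  ∃ N : KasparovModule A C(I, B), IsEvaluation 0 N M₀ ∧ IsEvaluation 1 N M₁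

end KasparovModule

/-- The set `KKR(A, B)` of classes of Real Kasparov `A`-`B`-modules modulo (the equivalence
relation generated by) homotopy, including unitary equivalence. -/
def KKR (A : Type v) (B : Type u) [NonUnitalCStarAlgebra A] [GradedRealCStarAlgebra A]
    [NonUnitalCStarAlgebra B] [GradedRealCStarAlgebra B] : Type (max v (u + 1)) :=
  Quot (KasparovModule.Homotopic (A := A) (B := B))

/-- The class of a Kasparov module. -/
def KKR.mk {A : Type v} {B : Type u} [NonUnitalCStarAlgebra A] [GradedRealCStarAlgebra A]
    [NonUnitalCStarAlgebra B] [GradedRealCStarAlgebra B] (M : KasparovModule A B) : KKR A B :=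
  Quot.mk _ M

/-- The neutral element of `KKR(A, B)` is the class of the zero module (equivalently, of any
degenerate module). -/
instance {A : Type v} {B : Type u} [NonUnitalCStarAlgebra A] [GradedRealCStarAlgebra A]
    [NonUnitalCStarAlgebra B] [GradedRealCStarAlgebra B] : Zero (KKR A B) :=
  ⟨KKR.mk (KasparovModule.zero A B)⟩

/-! ### The Clifford algebra `ℂℓ_{2,0}` -/

/-- The Clifford algebra `ℂℓ_{2,0}`, realised as the C*-algebra `M₂(ℂ)` with the Clifford
generators `γ₁ = !![0, 1; 1, 0]` and `γ₂ = !![1, 0; 0, -1]`. -/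
abbrev Cl20 : Type := CStarMatrix (Fin 2) (Fin 2) ℂ

namespace Cl20

/-- The first generator. -/
def γ₁ : Cl20 := CStarMatrix.ofMatrix !![0, 1; 1, 0]

/-- The second generator. -/
def γ₂ : Cl20 := CStarMatrix.ofMatrix !![1, 0; 0, -1]

open scoped ComplexOrder in
noncomputable instance : CStarAlgebra Cl20 := CStarMatrix.instCStarAlgebra

/-- The Real structure is entrywise conjugation; the grading automorphism is conjugation by
`γ₁ γ₂ = !![0, -1; 1, 0]`. -/
noncomputable instance : GradedRealCStarAlgebra Cl20 where
  conj m := CStarMatrix.ofMatrix !![star (m 0 0), star (m 0 1); star (m 1 0), star (m 1 1)]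
  conj_add a b := by ext i j; fin_cases i <;> fin_cases j <;> simp
  conj_smul z a := by ext i j; fin_cases i <;> fin_cases j <;> simp
  conj_mul a b := by
    ext i j; fin_cases i <;> fin_cases j <;> simp [CStarMatrix.mul_apply]
  conj_star a := by
    ext i j; fin_cases i <;> fin_cases j <;> simp [CStarMatrix.star_apply]
  conj_conj a := by ext i j; fin_cases i <;> fin_cases j <;> simp
  parity :=
    { toFun := fun m => CStarMatrix.ofMatrix !![m 1 1, -m 1 0; -m 0 1, m 0 0]
      map_smul' := fun z a => by ext i j; fin_cases i <;> fin_cases j <;> simp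
      map_zero' := by ext i j; fin_cases i <;> fin_cases j <;> simp
      map_add' := fun a b => by ext i j; fin_cases i <;> fin_cases j <;> simp [add_comm]
      map_mul' := fun a b => by
        ext i j; fin_cases i <;> fin_cases j <;> simp [CStarMatrix.mul_apply] <;> ring
      map_star' := fun a => by
        ext i j; fin_cases i <;> fin_cases j <;> simp [CStarMatrix.star_apply] }
  parity_parity a := by ext i j; fin_cases i <;> fin_cases j <;> simp
  parity_conj a := by ext i j; fin_cases i <;> fin_cases j <;> simp

/-- `γ₁, γ₂` are odd, Real, self-adjoint, anti-commuting, and square to `1`. -/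
lemma relations :
    star γ₁ = γ₁ ∧ star γ₂ = γ₂ ∧ conj γ₁ = γ₁ ∧ conj γ₂ = γ₂ ∧
    parity γ₁ = -γ₁ ∧ parity γ₂ = -γ₂ ∧
    γ₁ * γ₁ = 1 ∧ γ₂ * γ₂ = 1 ∧ γ₁ * γ₂ = -(γ₂ * γ₁) := by
  refine ⟨?_, ?_, ?_, ?_, ?_, ?_, ?_, ?_, ?_⟩ <;>
    (ext i j; fin_cases i <;> fin_cases j <;>
      simp [γ₁, γ₂, CStarMatrix.mul_apply, CStarMatrix.star_apply,
        conj, parity])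

/-- The universal property: two anti-commuting square roots `g₁, g₂` of `1` in a complex algebra
define a homomorphism on `ℂℓ_{2,0}` with `γ₁ ↦ g₁` and `γ₂ ↦ g₂`. -/
noncomputable def lift {R : Type u} [Ring R] [Algebra ℂ R] (g₁ g₂ : R) (h₁ : g₁ * g₁ = 1)
    (h₂ : g₂ * g₂ = 1) (h₁₂ : g₁ * g₂ = -(g₂ * g₁)) : Cl20 →ₙₐ[ℂ] R where
  toFun m := ((m 0 0 + m 1 1) / 2) • (1 : R) + ((m 0 1 + m 1 0) / 2) • g₁ +
    ((m 0 0 - m 1 1) / 2) • g₂ + ((m 1 0 - m 0 1) / 2) • (g₁ * g₂)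
  map_smul' z a := by simp; module
  map_zero' := by simp
  map_add' a b := by simp; module
  map_mul' a b := by
    have e1 : g₂ * g₁ = -(g₁ * g₂) := by rw [h₁₂, neg_neg]
    have e2 : g₁ * (g₁ * g₂) = g₂ := by rw [← mul_assoc, h₁, one_mul]
    have e3 : g₁ * g₂ * g₂ = g₁ := by rw [mul_assoc, h₂, mul_one]
    have e4 : g₁ * g₂ * g₁ = -g₂ := by rw [mul_assoc, e1, mul_neg, e2]
    have e5 : g₂ * (g₁ * g₂) = -g₁ := by rw [← mul_assoc, e1, neg_mul, e3]
    have e6 : g₁ * g₂ * (g₁ * g₂) = -1 := by rw [mul_assoc, e5, mul_neg, h₁]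
    simp only [CStarMatrix.mul_apply, Fin.sum_univ_two, add_mul, mul_add, smul_mul_smul_comm,
      one_mul, mul_one, h₁, h₂, e1, e2, e3, e4, e5, e6]
    module

lemma lift_γ₁ {R : Type u} [Ring R] [Algebra ℂ R] (g₁ g₂ : R) (h₁ : g₁ * g₁ = 1)
    (h₂ : g₂ * g₂ = 1) (h₁₂ : g₁ * g₂ = -(g₂ * g₁)) : lift g₁ g₂ h₁ h₂ h₁₂ γ₁ = g₁ := by
  simp [lift, γ₁]

lemma lift_γ₂ {R : Type u} [Ring R] [Algebra ℂ R] (g₁ g₂ : R) (h₁ : g₁ * g₁ = 1)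
    (h₂ : g₂ * g₂ = 1) (h₁₂ : g₁ * g₂ = -(g₂ * g₁)) : lift g₁ g₂ h₁ h₂ h₁₂ γ₂ = g₂ := by
  simp [lift, γ₂]

end Cl20

/-! ### Skew-adjoint Real unitaries in the multiplier algebra -/

section multiplier

variable {A : Type u} [NonUnitalCStarAlgebra A]

lemma DoubleCentralizer.star_fst_mul (m : 𝓜(ℂ, A)) (x y : A) :
    star (m.fst x) * y = star x * (star m).fst y := by
  have h := (star m).central (star x) y
  simpa using h

/-- Multipliers are right `A`-linear. -/
lemma DoubleCentralizer.fst_mul (m : 𝓜(ℂ, A)) (a b : A) : m.fst (a * b) = m.fst a * b := by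
  have h : ∀ x : A, x * (m.fst (a * b) - m.fst a * b) = 0 := fun x => by
    rw [mul_sub, ← m.central, ← mul_assoc x, ← m.central, mul_assoc, sub_self]
  have := h (star (m.fst (a * b) - m.fst a * b))
  rw [CStarRing.star_mul_self_eq_zero_iff] at this
  exact sub_eq_zero.mp this

lemma DoubleCentralizer.apply_apply {m n m' n' : 𝓜(ℂ, A)} (h : m * n = m' * n') (c : A) :
    m.fst (n.fst c) = m'.fst (n'.fst c) := by
  have := congrArg (fun k : 𝓜(ℂ, A) => k.fst c) h
  simpa using this

variable [GradedRealCStarAlgebra A]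

/-- The Real structure of `Mult(A)`: `m^𝔯 a = (m a^𝔯)^𝔯`. -/
noncomputable def multConj (m : 𝓜(ℂ, A)) : 𝓜(ℂ, A) where
  fst := ((conjₗᵢ A).toContinuousLinearMap.comp m.fst).comp (conjₗᵢ A).toContinuousLinearMap
  snd := ((conjₗᵢ A).toContinuousLinearMap.comp m.snd).comp (conjₗᵢ A).toContinuousLinearMap
  central x y := by
    change conj (m.snd (conj x)) * y = x * conj (m.fst (conj y))
    have := congrArg conj (m.central (conj x) (conj y))
    simpa [GradedRealCStarAlgebra.conj_mul, conj_conj] using this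

lemma multConj_fst (m : 𝓜(ℂ, A)) (a : A) : (multConj m).fst a = conj (m.fst (conj a)) := rfl

lemma multConj_snd (m : 𝓜(ℂ, A)) (a : A) : (multConj m).snd a = conj (m.snd (conj a)) := rfl

lemma multConj_mul (m n : 𝓜(ℂ, A)) : multConj (m * n) = multConj m * multConj n := by
  ext x <;> simp [multConj_fst, multConj_snd, conj_conj]

lemma multConj_star (m : 𝓜(ℂ, A)) : multConj (star m) = star (multConj m) := by
  ext x <;> simp [multConj_fst, multConj_snd, conj_star]

lemma multConj_sub (m n : 𝓜(ℂ, A)) : multConj (m - n) = multConj m - multConj n := by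
  have h : ∀ a b : A, conj (a - b) = conj a - conj b := (conjₗᵢ A).map_sub
  ext x <;> simp [multConj_fst, multConj_snd, h]

lemma multConj_add (m n : 𝓜(ℂ, A)) : multConj (m + n) = multConj m + multConj n := by
  ext x <;> simp [multConj_fst, multConj_snd, conj_add]

/-- `J` is a skew-adjoint Real unitary in `Mult(A)`. -/
structure IsRealSkewUnitary (J : 𝓜(ℂ, A)) : Prop where
  real : multConj J = J
  skew : star J = -J
  unitary : J ∈ unitary 𝓜(ℂ, A)

lemma IsRealSkewUnitary.mul_self {J : 𝓜(ℂ, A)} (h : IsRealSkewUnitary J) : J * J = -1 := by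
  have := (Unitary.mem_iff.mp h.unitary).1
  rw [h.skew, neg_mul] at this
  rw [← this, neg_neg]

end multiplier

/-- The absolute value `h = |T| = (T* T)^{1/2}` in a unital C*-algebra: `h` is positive,
`h² = T* T`, and `h` inherits commutation relations and Reality from `T* T`. -/
lemma exists_absolute_value {M : Type u} [CStarAlgebra M] (T : M) :
    ∃ h : M, (∃ q, h = star q * q) ∧ h * h = star T * T ∧
      (∀ x, Commute x (star T * T) → Commute x h) ∧
      (∀ k q : M, k = star q * q → k * k = star T * T → k = h) ∧
      (∀ ε > (0 : ℝ), ∃ w : M, ‖h - star T * T * w‖ ≤ ε) := by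
  let _ := CStarAlgebra.spectralOrder M
  let _ := CStarAlgebra.spectralOrderedRing M
  have h0 : 0 ≤ CFC.abs T := CFC.abs_nonneg T
  have hsq : CFC.abs T * CFC.abs T = star T * T := CFC.abs_mul_abs T
  refine ⟨CFC.abs T, ?_, hsq, ?_, ?_, ?_⟩
  · exact CStarAlgebra.nonneg_iff_eq_star_mul_self.mp h0
  · intro x hx
    exact (hx.symm.cfcₙ_nnreal _).symm
  · intro k q hk hkk
    have hk0 : 0 ≤ k := hk ▸ star_mul_self_nonneg q
    exact (CFC.sqrt_unique hkk hk0).symm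
  · intro ε hε
    have hsa : IsSelfAdjoint (CFC.abs T) := h0.isSelfAdjoint
    set h := CFC.abs T
    have hcont : Continuous (fun x : ℝ => (|x| + ε)⁻¹) :=
      (continuous_abs.add continuous_const).inv₀ fun x => (add_pos_of_nonneg_of_pos (abs_nonneg x) hε).ne'
    refine ⟨cfc (fun x : ℝ => (|x| + ε)⁻¹) h, ?_⟩
    rw [← hsq]
    have e : h - h * h * cfc (fun x : ℝ => (|x| + ε)⁻¹) h =
        cfc (fun x : ℝ => x - x * x * (|x| + ε)⁻¹) h := by
      rw [cfc_sub (fun x : ℝ => x) (fun x : ℝ => x * x * (|x| + ε)⁻¹) h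
        (by fun_prop) (Continuous.continuousOn (by fun_prop)),
        cfc_mul (fun x : ℝ => x * x) (fun x : ℝ => (|x| + ε)⁻¹) h (by fun_prop)
        hcont.continuousOn,
        cfc_mul (fun x : ℝ => x) (fun x : ℝ => x) h (by fun_prop) (by fun_prop), cfc_id' ℝ h]
    rw [e]
    refine norm_cfc_le hε.le fun x hx => ?_
    have hx0 : 0 ≤ x := spectrum_nonneg_of_nonneg h0 hx
    have hp : 0 < x + ε := by positivity
    rw [abs_of_nonneg hx0, Real.norm_eq_abs, abs_le]
    have : x - x * x * (x + ε)⁻¹ = x * ε / (x + ε) := by field_simp; ring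
    rw [this]
    refine ⟨le_trans (by linarith) (by positivity : (0:ℝ) ≤ x * ε / (x + ε)), ?_⟩
    rw [div_le_iff₀ hp]
    nlinarith

/-! ### The Cayley transform and its class -/

section ideal

variable {A : Type u} [NonUnitalCStarAlgebra A]

lemma exists_star_mul_self_add (a b : A) : ∃ c : A, star a * a + star b * b = star c * c := by
  let _ := CStarAlgebra.spectralOrder A
  let _ := CStarAlgebra.spectralOrderedRing A
  exact CStarAlgebra.nonneg_iff_eq_star_mul_self.mp
    (add_nonneg (star_mul_self_nonneg a) (star_mul_self_nonneg b))

lemma norm_sq_le_norm_add (a b : A) : ‖a‖ ^ 2 ≤ ‖star a * a + star b * b‖ := by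
  let _ := CStarAlgebra.spectralOrder A
  let _ := CStarAlgebra.spectralOrderedRing A
  have := CStarAlgebra.norm_le_norm_of_nonneg_of_le (star_mul_self_nonneg a)
    (le_add_of_nonneg_right (star_mul_self_nonneg b) : star a * a ≤ star a * a + star b * b)
  rwa [CStarRing.norm_star_mul_self, ← sq] at this

lemma norm_add_le_norm_sq (a b : A) :
    ‖star a * a + star b * b‖ ≤ ‖a‖ ^ 2 + ‖b‖ ^ 2 := by
  refine (norm_add_le _ _).trans ?_
  rw [CStarRing.norm_star_mul_self, CStarRing.norm_star_mul_self, sq, sq]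

lemma eq_zero_of_star_mul_add (a b : A) (h : star a * a + star b * b = 0) : a = 0 ∧ b = 0 := by
  have h1 := norm_sq_le_norm_add a b
  have h2 := norm_sq_le_norm_add b a
  rw [add_comm] at h2
  rw [h, norm_zero] at h1 h2
  exact ⟨norm_eq_zero.mp (pow_eq_zero_iff two_ne_zero |>.mp (le_antisymm h1 (by positivity))),
    norm_eq_zero.mp (pow_eq_zero_iff two_ne_zero |>.mp (le_antisymm h2 (by positivity)))⟩

lemma mem_closure_mul (a : A) : ∀ ε > 0, ∃ u : A, ‖a - a * u‖ < ε := by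
  let _ := CStarAlgebra.spectralOrder A
  let _ := CStarAlgebra.spectralOrderedRing A
  intro ε hε
  have h := (CStarAlgebra.increasingApproximateUnit A).tendsto_mul_left a
  obtain ⟨u, hu⟩ := ((Metric.tendsto_nhds.mp h) ε hε).exists
  exact ⟨u, by rwa [dist_eq_norm, norm_sub_rev] at hu⟩

variable [GradedRealCStarAlgebra A]

/-- For a closed Real right ideal `X` of a trivially graded Real C*-algebra `A`, the Hilbert
`A`-module `X ⊗ ⋀* ℂ = X ⊕ X`, with even part `X ⊗ 1` (first summand) and odd part the second
summand.  The inner product of `X` is `(x ∣ y) = x* y`. -/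
def idealTensorExterior (hA : TriviallyGraded A) (X : Submodule ℂ A)
    (hX : IsClosed (X : Set A)) (hmul : ∀ x ∈ X, ∀ a, x * a ∈ X)
    (hconj : ∀ x ∈ X, conj x ∈ X) : RealHilbertModule A where
  carrier := X × X
  rsmul x b := (⟨x.1 * b, hmul _ x.1.2 b⟩, ⟨x.2 * b, hmul _ x.2.2 b⟩)
  add_rsmul x y b := by ext <;> simp [add_mul]
  rsmul_add x b c := by ext <;> simp [mul_add]
  rsmul_mul x b c := by ext <;> simp [mul_assoc]
  smul_rsmul z x b := by ext <;> simp [smul_mul_assoc]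
  rsmul_smul z x b := by ext <;> simp [mul_smul_comm]
  inner x y := star (x.1 : A) * y.1 + star (x.2 : A) * y.2
  inner_add_right x y z := by simp [mul_add]; abel
  inner_smul_right c x y := by simp [mul_smul_comm]
  inner_rsmul_right x y b := by simp [add_mul, mul_assoc]
  star_inner x y := by simp
  inner_self_nonneg x := exists_star_mul_self_add _ _
  inner_self_eq_zero x h := by
    obtain ⟨h1, h2⟩ := eq_zero_of_star_mul_add _ _ h
    ext
    · simpa using h1
    · simpa using h2
  complete s hs := by
    have key : ∀ f : ℕ → X, (∀ m n, ‖f m - f n‖ ^ 2 ≤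
        ‖star (((s m).1 - (s n).1 : X) : A) * (((s m).1 - (s n).1 : X) : A) +
          star (((s m).2 - (s n).2 : X) : A) * (((s m).2 - (s n).2 : X) : A)‖) →
        ∃ x : X, Tendsto f atTop (𝓝 x) := by
      intro f hf
      have : CompleteSpace X := hX.completeSpace_coe
      refine cauchySeq_tendsto_of_complete (Metric.cauchySeq_iff.mpr fun ε hε => ?_)
      have h1 := (Metric.tendsto_nhds.mp hs) (ε ^ 2) (by positivity)
      obtain ⟨N, hN⟩ := eventually_atTop_prod_self'.mp h1
      refine ⟨N, fun m hm n hn => ?_⟩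
      have h2 := hN m hm n hn
      rw [dist_zero_right, norm_norm] at h2
      have h3 := (hf m n).trans_lt h2
      rw [dist_eq_norm]
      exact lt_of_pow_lt_pow_left₀ 2 hε.le h3
    obtain ⟨x, hx⟩ := key (fun n => (s n).1) fun m n => norm_sq_le_norm_add _ _
    obtain ⟨y, hy⟩ := key (fun n => (s n).2) fun m n => by
      rw [add_comm]; exact norm_sq_le_norm_add _ _
    refine ⟨(x, y), ?_⟩
    have hx' := (tendsto_iff_norm_sub_tendsto_zero.mp hx).pow 2
    have hy' := (tendsto_iff_norm_sub_tendsto_zero.mp hy).pow 2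
    refine squeeze_zero (fun _ => norm_nonneg _) (fun n => norm_add_le_norm_sq _ _)
      (by simpa using hx'.add hy')
  conj x := (⟨conj x.1, hconj _ x.1.2⟩, ⟨conj x.2, hconj _ x.2.2⟩)
  conj_add x y := by ext <;> simp [conj_add]
  conj_smul z x := by ext <;> simp [conj_smul]
  conj_conj x := by ext <;> simp [conj_conj]
  conj_rsmul x b := by ext <;> simp [GradedRealCStarAlgebra.conj_mul]
  inner_conj x y := by simp [conj_add, GradedRealCStarAlgebra.conj_mul, conj_star]
  parity :=
    { toFun := fun x => (x.1, -x.2)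
      map_add' := fun x y => by ext <;> simp [add_comm]
      map_smul' := fun z x => by ext <;> simp }
  parity_parity x := by ext <;> simp
  parity_rsmul x b := by ext <;> simp [hA b]
  inner_parity x y := by simp [hA _]
  parity_conj x := by ext <;> simp [conj_neg]

end ideal

/-- A pair `J₀, J₁` of skew-adjoint Real unitaries in `Mult(A)` with `J₁ - J₀ ∈ A`, where `A` is a
trivially graded Real C*-algebra. -/
structure LocalPair (A : Type u) [NonUnitalCStarAlgebra A] [GradedRealCStarAlgebra A] where
  triviallyGraded : TriviallyGraded A
  J₀ : 𝓜(ℂ, A)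
  J₁ : 𝓜(ℂ, A)
  h₀ : IsRealSkewUnitary J₀
  h₁ : IsRealSkewUnitary J₁
  sub_mem : J₁ - J₀ ∈ Set.range (DoubleCentralizer.coe ℂ : A → 𝓜(ℂ, A))

namespace LocalPair

variable {A : Type u} [NonUnitalCStarAlgebra A] [GradedRealCStarAlgebra A] (P : LocalPair A)

/-- `J₁ - J₀`. -/
noncomputable def T : 𝓜(ℂ, A) := P.J₁ - P.J₀

/-- `J₁ + J₀`. -/
noncomputable def S : 𝓜(ℂ, A) := P.J₁ + P.J₀

lemma J₀_mul_T : P.J₀ * P.T = P.T * -P.J₁ := by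
  simp only [T, mul_sub, sub_mul, mul_neg, P.h₀.mul_self, P.h₁.mul_self]; abel

lemma J₁_mul_T : P.J₁ * P.T = P.T * -P.J₀ := by
  simp only [T, mul_sub, sub_mul, mul_neg, P.h₀.mul_self, P.h₁.mul_self]; abel

lemma S_mul_T : P.S * P.T = P.T * -P.S := by
  simp only [T, S, mul_sub, sub_mul, mul_neg, add_mul, mul_add, P.h₀.mul_self, P.h₁.mul_self]; abel

lemma J₀_mul_S : P.J₀ * P.S = P.S * P.J₁ := by
  simp only [S, add_mul, mul_add, P.h₀.mul_self, P.h₁.mul_self]; abel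

lemma J₁_mul_S : P.J₁ * P.S = P.S * P.J₀ := by
  simp only [S, add_mul, mul_add, P.h₀.mul_self, P.h₁.mul_self]; abel

lemma star_T : star P.T = -P.T := by
  simp only [T, star_sub, P.h₀.skew, P.h₁.skew]; abel

lemma star_S : star P.S = -P.S := by
  simp only [S, star_add, P.h₀.skew, P.h₁.skew]; abel

lemma T_sq_add_S_sq : P.T * P.T + P.S * P.S = -4 := by
  have : P.T * P.T + P.S * P.S = 2 * (P.J₀ * P.J₀) + 2 * (P.J₁ * P.J₁) := by
    simp only [T, S]; noncomm_ring
  rw [this, P.h₀.mul_self, P.h₁.mul_self]; norm_num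

lemma real_T : multConj P.T = P.T := by
  rw [T, multConj_sub, P.h₀.real, P.h₁.real]

lemma real_S : multConj P.S = P.S := by
  rw [S, multConj_add, P.h₀.real, P.h₁.real]

/-- The closed right ideal `X`, the closure of `(J₁ - J₀) A`. -/
noncomputable def X : Submodule ℂ A :=
  (LinearMap.range (P.T.fst : A →ₗ[ℂ] A)).topologicalClosure

lemma isClosed_X : IsClosed (P.X : Set A) := Submodule.isClosed_topologicalClosure _

lemma T_mem_X (a : A) : P.T.fst a ∈ P.X :=
  Submodule.le_topologicalClosure _ ⟨a, rfl⟩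

/-- To prove a closed property on `X` it suffices to check it on `(J₁ - J₀) A`. -/
lemma induction_X {p : A → Prop} (hp : IsClosed {x | p x}) (h : ∀ a, p (P.T.fst a)) :
    ∀ x ∈ P.X, p x := by
  intro x hx
  have hx' : x ∈ closure ((LinearMap.range (P.T.fst : A →ₗ[ℂ] A) : Submodule ℂ A) : Set A) := hx
  refine closure_minimal (t := {x | p x}) ?_ hp hx'
  rintro _ ⟨a, rfl⟩
  exact h a

lemma mul_mem_X : ∀ x ∈ P.X, ∀ a, x * a ∈ P.X := by
  intro x hx a
  refine P.induction_X (p := fun x => x * a ∈ P.X)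
    (P.isClosed_X.preimage (continuous_mul_const a)) (fun c => ?_) x hx
  rw [← DoubleCentralizer.fst_mul]
  exact P.T_mem_X _

lemma conj_mem_X : ∀ x ∈ P.X, conj x ∈ P.X := by
  refine P.induction_X (P.isClosed_X.preimage continuous_conj) fun c => ?_
  have : conj (P.T.fst c) = P.T.fst (conj c) := by
    conv_rhs => rw [← P.real_T, multConj_fst, conj_conj]
  change conj (P.T.fst c) ∈ P.X
  rw [this]
  exact P.T_mem_X _

/-- `m X ⊆ X` if `m (J₁ - J₀) = (J₁ - J₀) n`. -/
lemma act_mem_X {m n : 𝓜(ℂ, A)} (h : m * P.T = P.T * n) : ∀ x ∈ P.X, m.fst x ∈ P.X := by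
  refine P.induction_X (P.isClosed_X.preimage m.fst.continuous) fun c => ?_
  have : m.fst (P.T.fst c) = P.T.fst (n.fst c) := by
    have := congrArg (fun k : 𝓜(ℂ, A) => k.fst c) h
    simpa using this
  change m.fst (P.T.fst c) ∈ P.X
  rw [this]
  exact P.T_mem_X _

/-- Restriction of a multiplier to an operator on `X`. -/
noncomputable def restrict (m : 𝓜(ℂ, A)) (hm : ∀ x ∈ P.X, m.fst x ∈ P.X) : P.X →ₗ[ℂ] P.X :=
  (m.fst : A →ₗ[ℂ] A).restrict hm

@[simp]
lemma coe_restrict (m : 𝓜(ℂ, A)) (hm : ∀ x ∈ P.X, m.fst x ∈ P.X) (x : P.X) :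
    ((P.restrict m hm x : P.X) : A) = m.fst (x : A) := rfl

/-- `J₀` on `X`. -/
noncomputable def J₀X : P.X →ₗ[ℂ] P.X := P.restrict P.J₀ (P.act_mem_X P.J₀_mul_T)

/-- `J₁ - J₀` on `X`. -/
noncomputable def TX : P.X →ₗ[ℂ] P.X := P.restrict P.T (P.act_mem_X rfl)

/-- `J₁ + J₀` on `X`. -/
noncomputable def SX : P.X →ₗ[ℂ] P.X := P.restrict P.S (P.act_mem_X P.S_mul_T)

lemma TX_injective : Function.Injective P.TX := by
  rw [injective_iff_map_eq_zero]
  intro x hx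
  have hx' : P.T.fst (x : A) = 0 := congrArg Subtype.val hx
  have h : ∀ y ∈ P.X, star y * (x : A) = 0 := by
    refine P.induction_X (isClosed_eq (by fun_prop) continuous_const) fun c => ?_
    rw [DoubleCentralizer.star_fst_mul, P.star_T, DoubleCentralizer.neg_fst]
    simp [hx']
  have := h x x.2
  rw [CStarRing.star_mul_self_eq_zero_iff] at this
  exact Subtype.ext this

/-- The Cayley transform `𝒞_{J₀}(J₁) = J₀ (J₁ + J₀) (J₁ - J₀)⁻¹`, an unbounded operator on `X`
with domain `(J₁ - J₀) X`. -/
noncomputable def cayley : P.X →ₗ.[ℂ] P.X where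
  domain := LinearMap.range P.TX
  toFun := P.J₀X ∘ₗ P.SX ∘ₗ (LinearEquiv.ofInjective P.TX P.TX_injective).symm.toLinearMap

/-- The Hilbert module `X ⊗ ⋀* ℂ`. -/
noncomputable def module : RealHilbertModule A :=
  idealTensorExterior P.triviallyGraded P.X P.isClosed_X P.mul_mem_X P.conj_mem_X

/-- `1 ⊗ γ` on `X ⊗ ⋀* ℂ`, where `γ = !![0, 1; 1, 0]`. -/
noncomputable def oneγ : Module.End ℂ (P.X × P.X) :=
  (LinearMap.snd ℂ P.X P.X).prod (LinearMap.fst ℂ P.X P.X)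

/-- `L ⊗ ρ` on `X ⊗ ⋀* ℂ`, where `ρ = !![0, -1; 1, 0]`. -/
noncomputable def tensorρ (L : P.X →ₗ[ℂ] P.X) : Module.End ℂ (P.X × P.X) :=
  (-(L ∘ₗ LinearMap.snd ℂ P.X P.X)).prod (L ∘ₗ LinearMap.fst ℂ P.X P.X)

/-- `D ⊗ ρ` on `X ⊗ ⋀* ℂ` for an unbounded operator `D` on `X`. -/
noncomputable def unboundedTensorρ (D : P.X →ₗ.[ℂ] P.X) :
    (P.X × P.X) →ₗ.[ℂ] (P.X × P.X) where
  domain := D.domain.prod D.domain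
  toFun :=
    { toFun := fun z => (-D ⟨z.1.2, z.2.2⟩, D ⟨z.1.1, z.2.1⟩)
      map_add' := fun z w => by
        have h1 := D.map_add ⟨z.1.1, z.2.1⟩ ⟨w.1.1, w.2.1⟩
        have h2 := D.map_add ⟨z.1.2, z.2.2⟩ ⟨w.1.2, w.2.2⟩
        ext1
        · change -D (⟨z.1.2, z.2.2⟩ + ⟨w.1.2, w.2.2⟩) = _
          rw [h2, neg_add]; rfl
        · exact h1
      map_smul' := fun c z => by
        have h1 := D.map_smul c ⟨z.1.1, z.2.1⟩
        have h2 := D.map_smul c ⟨z.1.2, z.2.2⟩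
        ext1
        · change -D (c • ⟨z.1.2, z.2.2⟩) = _
          rw [h2, ← smul_neg]; rfl
        · exact h1 }

end LocalPair

namespace LocalPair

variable {A : Type u} [NonUnitalCStarAlgebra A] [GradedRealCStarAlgebra A] (P : LocalPair A)

/-- `|J₁ - J₀|`, the positive square root of `(J₁ - J₀)* (J₁ - J₀)`. -/
noncomputable def absT : 𝓜(ℂ, A) := Classical.choose (exists_absolute_value P.T)

lemma absT_pos : ∃ q, P.absT = star q * q :=
  (Classical.choose_spec (exists_absolute_value P.T)).1

lemma absT_mul_absT : P.absT * P.absT = -(P.T * P.T) := by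
  rw [← neg_mul, ← P.star_T]
  exact (Classical.choose_spec (exists_absolute_value P.T)).2.1

lemma commute_absT (x : 𝓜(ℂ, A)) (hx : Commute x (P.T * P.T)) : Commute x P.absT := by
  refine (Classical.choose_spec (exists_absolute_value P.T)).2.2.1 x ?_
  rw [P.star_T, neg_mul]
  exact hx.neg_right

lemma absT_unique (k q : 𝓜(ℂ, A)) (hk : k = star q * q) (hkk : k * k = -(P.T * P.T)) :
    k = P.absT := by
  refine (Classical.choose_spec (exists_absolute_value P.T)).2.2.2.1 k q hk ?_
  rw [hkk, P.star_T, neg_mul]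

lemma star_absT : star P.absT = P.absT := by
  obtain ⟨q, hq⟩ := P.absT_pos
  rw [hq]; simp

lemma real_absT : multConj P.absT = P.absT := by
  obtain ⟨q, hq⟩ := P.absT_pos
  refine P.absT_unique _ (multConj q) ?_ ?_
  · rw [hq, multConj_mul, multConj_star]
  · have hneg : ∀ m : 𝓜(ℂ, A), multConj (-m) = -multConj m := fun m => by
      ext x <;> simp [multConj_fst, multConj_snd, conj_neg]
    rw [← multConj_mul, absT_mul_absT, hneg, multConj_mul, P.real_T]

lemma commute_T : Commute P.T P.absT := P.commute_absT _ (Commute.mul_right rfl rfl)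

lemma commute_S : Commute P.S P.absT := by
  refine P.commute_absT _ ?_
  change P.S * (P.T * P.T) = P.T * P.T * P.S
  rw [← mul_assoc, S_mul_T, mul_assoc, neg_mul, S_mul_T, mul_assoc]; simp

lemma commute_J₁ : Commute P.J₁ P.absT := by
  refine P.commute_absT _ ?_
  change P.J₁ * (P.T * P.T) = P.T * P.T * P.J₁
  rw [← mul_assoc, J₁_mul_T, mul_assoc, neg_mul, J₀_mul_T, mul_assoc]; simp

lemma commute_J₀ : Commute P.J₀ P.absT := by
  refine P.commute_absT _ ?_
  change P.J₀ * (P.T * P.T) = P.T * P.T * P.J₀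
  rw [← mul_assoc, J₀_mul_T, mul_assoc, neg_mul, J₁_mul_T, mul_assoc]; simp

lemma absT_mem_X (c : A) : P.absT.fst c ∈ P.X := by
  change P.absT.fst c ∈ (P.X : Set A)
  rw [← P.isClosed_X.closure_eq, Metric.mem_closure_iff]
  intro ε hε
  obtain ⟨w, hw⟩ := (Classical.choose_spec (exists_absolute_value P.T)).2.2.2.2
    (ε / (2 * (‖c‖ + 1))) (by positivity)
  change ‖P.absT - star P.T * P.T * w‖ ≤ _ at hw
  refine ⟨(star P.T * P.T * w).fst c, ?_, ?_⟩
  · rw [P.star_T, mul_assoc, neg_mul, ← mul_neg]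
    exact P.T_mem_X _
  · rw [dist_eq_norm]
    have : P.absT.fst c - (star P.T * P.T * w).fst c = (P.absT - star P.T * P.T * w).fst c := by
      simp
    rw [this]
    refine (ContinuousLinearMap.le_opNorm _ _).trans_lt ?_
    rw [DoubleCentralizer.norm_fst]
    have h1 : ‖P.absT - star P.T * P.T * w‖ * ‖c‖ ≤ ε / (2 * (‖c‖ + 1)) * (‖c‖ + 1) := by
      gcongr; linarith
    have h2 : ε / (2 * (‖c‖ + 1)) * (‖c‖ + 1) = ε / 2 := by field_simp
    linarith

/-- `|J₁ - J₀|` on `X`. -/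
noncomputable def absTX : P.X →ₗ[ℂ] P.X := P.restrict P.absT fun x _ => P.absT_mem_X x

/-- `c ↦ (J₁ - J₀) c`, as a map `A → X` with dense range. -/
noncomputable def toX : A →ₗ[ℂ] P.X := (P.T.fst : A →ₗ[ℂ] A).codRestrict P.X P.T_mem_X

lemma denseRange_toX : DenseRange P.toX := by
  intro x
  rw [Metric.mem_closure_iff]
  intro ε hε
  have hx : (x : A) ∈ closure ((LinearMap.range (P.T.fst : A →ₗ[ℂ] A) : Submodule ℂ A) : Set A) :=
    x.2
  obtain ⟨_, ⟨c, rfl⟩, hc⟩ := Metric.mem_closure_iff.mp hx ε hε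
  exact ⟨P.toX c, ⟨c, rfl⟩, hc⟩

instance instCompleteX : CompleteSpace P.X := P.isClosed_X.completeSpace_coe

/-- The isometry `(J₁ - J₀)⁻¹ |J₁ - J₀|` of `X`: the continuous extension of
`(J₁ - J₀) c ↦ |J₁ - J₀| c`. -/
noncomputable def phase : P.X →L[ℂ] P.X :=
  ((P.absT.fst : A →ₗ[ℂ] A).codRestrict P.X P.absT_mem_X).extendOfNorm P.toX

lemma inner_absT (c d : A) :
    star (P.absT.fst c) * P.absT.fst d = star (P.T.fst c) * P.T.fst d := by
  have h : (star P.absT * P.absT).fst d = (star P.T * P.T).fst d := by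
    rw [P.star_absT, P.absT_mul_absT, P.star_T, neg_mul]
  rw [DoubleCentralizer.star_fst_mul, DoubleCentralizer.star_fst_mul]
  exact congrArg (star c * ·) h

lemma norm_absT (c : A) : ‖P.absT.fst c‖ = ‖P.T.fst c‖ := by
  have := congrArg norm (P.inner_absT c c)
  rw [CStarRing.norm_star_mul_self, CStarRing.norm_star_mul_self, ← sq, ← sq] at this
  exact (pow_left_inj₀ (norm_nonneg _) (norm_nonneg _) two_ne_zero).mp this

lemma phase_toX (c : A) : P.phase (P.toX c) = ⟨P.absT.fst c, P.absT_mem_X c⟩ := by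
  refine LinearMap.extendOfNorm_eq P.denseRange_toX ⟨1, fun x => ?_⟩ c
  rw [one_mul]
  exact (P.norm_absT x).le

/-- To prove a closed property of elements of `X` it suffices to check it on `(J₁ - J₀) A`. -/
lemma induction_toX {p : P.X → Prop} (hp : IsClosed {x | p x}) (h : ∀ a, p (P.toX a)) :
    ∀ x, p x := fun x => P.denseRange_toX.induction_on x hp h

lemma continuous_restrict (m : 𝓜(ℂ, A)) (hm : ∀ x ∈ P.X, m.fst x ∈ P.X) :
    Continuous (P.restrict m hm) :=
  (m.fst.continuous.comp continuous_subtype_val).subtype_mk _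

lemma TX_phase (x : P.X) : P.TX (P.phase x) = P.absTX x := by
  revert x
  refine P.induction_toX (isClosed_eq
    ((P.continuous_restrict _ _).comp P.phase.continuous) (P.continuous_restrict _ _)) fun c => ?_
  rw [phase_toX]
  exact Subtype.ext (DoubleCentralizer.apply_apply P.commute_T c)

/-- `J₁` on `X`. -/
noncomputable def J₁X : P.X →ₗ[ℂ] P.X := P.restrict P.J₁ (P.act_mem_X P.J₁_mul_T)

lemma restrict_toX {m n : 𝓜(ℂ, A)} (hm : ∀ x ∈ P.X, m.fst x ∈ P.X) (h : m * P.T = P.T * n)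
    (c : A) : P.restrict m hm (P.toX c) = P.toX (n.fst c) :=
  Subtype.ext (DoubleCentralizer.apply_apply h c)

lemma phase_restrict {m n : 𝓜(ℂ, A)} (hm : ∀ x ∈ P.X, m.fst x ∈ P.X)
    (hn : ∀ x ∈ P.X, n.fst x ∈ P.X) (h : m * P.T = P.T * n) (h' : Commute n P.absT)
    (x : P.X) : P.phase (P.restrict m hm x) = P.restrict n hn (P.phase x) := by
  revert x
  refine P.induction_toX (isClosed_eq (P.phase.continuous.comp (P.continuous_restrict _ _))
    ((P.continuous_restrict _ _).comp P.phase.continuous)) fun c => ?_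
  rw [P.restrict_toX hm h, phase_toX, phase_toX]
  exact Subtype.ext (DoubleCentralizer.apply_apply h'.eq.symm c)

lemma phase_J₀ (x : P.X) : P.phase (P.J₀X x) = -P.J₁X (P.phase x) := by
  refine (P.phase_restrict _ (fun x hx => ?_) P.J₀_mul_T P.commute_J₁.neg_left x).trans ?_
  · rw [DoubleCentralizer.neg_fst]
    exact P.X.neg_mem (P.act_mem_X P.J₁_mul_T x hx)
  · exact Subtype.ext (by simp [J₁X])

lemma phase_J₁ (x : P.X) : P.phase (P.J₁X x) = -P.J₀X (P.phase x) := by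
  refine (P.phase_restrict _ (fun x hx => ?_) P.J₁_mul_T P.commute_J₀.neg_left x).trans ?_
  · rw [DoubleCentralizer.neg_fst]
    exact P.X.neg_mem (P.act_mem_X P.J₀_mul_T x hx)
  · exact Subtype.ext (by simp [J₀X])

lemma phase_S (x : P.X) : P.phase (P.SX x) = -P.SX (P.phase x) := by
  refine (P.phase_restrict _ (fun x hx => ?_) P.S_mul_T P.commute_S.neg_left x).trans ?_
  · rw [DoubleCentralizer.neg_fst]
    exact P.X.neg_mem (P.act_mem_X P.S_mul_T x hx)
  · exact Subtype.ext (by simp [SX])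

lemma J₀X_SX (x : P.X) : P.J₀X (P.SX x) = P.SX (P.J₁X x) :=
  Subtype.ext (DoubleCentralizer.apply_apply P.J₀_mul_S (x : A))

lemma J₁X_SX (x : P.X) : P.J₁X (P.SX x) = P.SX (P.J₀X x) :=
  Subtype.ext (DoubleCentralizer.apply_apply P.J₁_mul_S (x : A))

lemma J₀X_J₀X (x : P.X) : P.J₀X (P.J₀X x) = -x := by
  have := congrArg (fun k : 𝓜(ℂ, A) => k.fst (x : A)) P.h₀.mul_self
  exact Subtype.ext (by simpa [J₀X] using this)

lemma TX_TX_add_SX_SX (x : P.X) : P.TX (P.TX x) + P.SX (P.SX x) = (-4 : ℂ) • x := by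
  have := congrArg (fun k : 𝓜(ℂ, A) => k.fst (x : A)) P.T_sq_add_S_sq
  have h4 : ((-4 : 𝓜(ℂ, A))) = (-4 : ℂ) • 1 := by
    rw [neg_smul, ← Algebra.algebraMap_eq_smul_one, map_ofNat]
  rw [h4] at this
  exact Subtype.ext (by simpa [TX, SX, DoubleCentralizer.one_fst] using this)

lemma inner_phase_phase (x y : P.X) :
    star (P.phase x : A) * (P.phase y : A) = star (x : A) * y := by
  revert x
  refine P.induction_toX (isClosed_eq (by fun_prop) (by fun_prop)) fun c => ?_
  revert y
  refine P.induction_toX (isClosed_eq (by fun_prop) (by fun_prop)) fun d => ?_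
  rw [phase_toX, phase_toX]
  exact P.inner_absT c d

lemma inner_phase (x y : P.X) :
    star (P.phase x : A) * (y : A) = -(star (x : A) * (P.phase y : A)) := by
  revert x
  refine P.induction_toX (isClosed_eq (by fun_prop) (by fun_prop)) fun c => ?_
  revert y
  refine P.induction_toX (isClosed_eq (by fun_prop) (by fun_prop)) fun d => ?_
  rw [phase_toX, phase_toX]
  change star (P.absT.fst c) * P.T.fst d = -(star (P.T.fst c) * P.absT.fst d)
  rw [DoubleCentralizer.star_fst_mul, DoubleCentralizer.star_fst_mul, P.star_absT, P.star_T,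
    DoubleCentralizer.neg_fst, DoubleCentralizer.apply_apply P.commute_T.eq.symm d]
  simp

lemma phase_phase (x : P.X) : P.phase (P.phase x) = -x := by
  have h : ∀ y : P.X, star (y : A) * ((P.phase (P.phase x) + x : P.X) : A) = 0 := fun y => by
    have h1 := P.inner_phase y (P.phase x)
    rw [inner_phase_phase] at h1
    rw [Submodule.coe_add, mul_add, h1]
    simp
  have := h (P.phase (P.phase x) + x)
  rw [CStarRing.star_mul_self_eq_zero_iff] at this
  exact eq_neg_of_add_eq_zero_left (Subtype.ext this)

/-- The bounded transform
`F = 𝒞 (1 - 𝒞²)^{-1/2} = ½ J₀ (J₁ + J₀) (J₁ - J₀)⁻¹ |J₁ - J₀|` of the Cayley transform, on `X`. -/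
noncomputable def FX : P.X →ₗ[ℂ] P.X :=
  (1 / 2 : ℂ) • (P.J₀X ∘ₗ P.SX ∘ₗ (P.phase : P.X →ₗ[ℂ] P.X))

lemma FX_apply (x : P.X) : P.FX x = (1 / 2 : ℂ) • P.J₀X (P.SX (P.phase x)) := rfl

lemma FX_J₀X (x : P.X) : P.FX (P.J₀X x) = -P.J₀X (P.FX x) := by
  rw [FX_apply, FX_apply, phase_J₀, map_neg, ← J₀X_SX, map_neg, map_smul, smul_neg]

lemma FX_FX (x : P.X) : P.FX (P.FX x) = (1 / 4 : ℂ) • P.SX (P.SX x) := by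
  simp only [FX_apply, map_smul, phase_J₀, phase_S, phase_phase, map_neg, neg_neg]
  rw [smul_smul, ← J₀X_SX, J₀X_J₀X, neg_neg]
  norm_num

lemma inner_restrict (m : 𝓜(ℂ, A)) (hm : ∀ x ∈ P.X, m.fst x ∈ P.X) (h : star m = -m)
    (x y : P.X) :
    star (P.restrict m hm x : A) * (y : A) = -(star (x : A) * (P.restrict m hm y : A)) := by
  rw [coe_restrict, coe_restrict, DoubleCentralizer.star_fst_mul, h]
  simp

lemma inner_J₀X (x y : P.X) :
    star (P.J₀X x : A) * (y : A) = -(star (x : A) * (P.J₀X y : A)) :=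
  P.inner_restrict _ _ P.h₀.skew x y

lemma inner_SX (x y : P.X) :
    star (P.SX x : A) * (y : A) = -(star (x : A) * (P.SX y : A)) :=
  P.inner_restrict _ _ P.star_S x y

lemma inner_FX (x y : P.X) :
    star (P.FX x : A) * (y : A) = -(star (x : A) * (P.FX y : A)) := by
  have h : P.phase (P.SX (P.J₀X y)) = P.J₀X (P.SX (P.phase y)) := by
    rw [phase_S, phase_J₀, map_neg, neg_neg, J₀X_SX]
  rw [FX_apply, FX_apply, Submodule.coe_smul, Submodule.coe_smul, star_smul, smul_mul_assoc,
    inner_J₀X, inner_SX, inner_phase, h, neg_neg, mul_smul_comm, smul_neg]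
  simp

lemma conj_restrict (m : 𝓜(ℂ, A)) (h : multConj m = m) (a : A) :
    m.fst (conj a) = conj (m.fst a) := by
  conv_lhs => rw [← h, multConj_fst, conj_conj]

lemma conj_phase (x : P.X) :
    P.phase ⟨conj (x : A), P.conj_mem_X x x.2⟩ =
      ⟨conj (P.phase x : A), P.conj_mem_X _ (P.phase x).2⟩ := by
  revert x
  refine P.induction_toX (isClosed_eq
    (P.phase.continuous.comp ((continuous_conj.comp continuous_subtype_val).subtype_mk _))
    ((continuous_conj.comp (continuous_subtype_val.comp P.phase.continuous)).subtype_mk _))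
    fun c => ?_
  have : (⟨conj (P.toX c : A), P.conj_mem_X _ (P.toX c).2⟩ : P.X) = P.toX (conj c) :=
    Subtype.ext (conj_restrict P.T P.real_T c).symm
  rw [this, phase_toX]
  refine Subtype.ext ?_
  rw [phase_toX]
  exact conj_restrict P.absT P.real_absT c

lemma conj_FX (x : P.X) :
    (P.FX ⟨conj (x : A), P.conj_mem_X x x.2⟩ : A) = conj (P.FX x : A) := by
  rw [FX_apply, FX_apply, conj_phase, Submodule.coe_smul, Submodule.coe_smul, conj_smul]
  change (1 / 2 : ℂ) • P.J₀.fst (P.S.fst (conj _)) =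
    star (1 / 2 : ℂ) • conj (P.J₀.fst (P.S.fst _))
  rw [conj_restrict P.S P.real_S, conj_restrict P.J₀ P.h₀.real]
  simp

end LocalPair

namespace LocalPair

variable {A : Type u} [NonUnitalCStarAlgebra A] [GradedRealCStarAlgebra A] (P : LocalPair A)

lemma cayley_apply (x : P.X) (h : P.TX x ∈ P.cayley.domain) :
    P.cayley ⟨P.TX x, h⟩ = P.J₀X (P.SX x) := by
  change P.J₀X (P.SX ((LinearEquiv.ofInjective P.TX P.TX_injective).symm ⟨P.TX x, h⟩)) = _
  congr 2
  exact (LinearEquiv.ofInjective P.TX P.TX_injective).symm_apply_apply x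

/-- The bounded transform `F ⊗ ρ` of the operator `𝒞_{J₀}(J₁) ⊗ ρ` on `X ⊗ ⋀* ℂ`. -/
noncomputable def F : Module.End ℂ P.module.carrier := P.tensorρ P.FX

lemma cayley_half_absTX (x : P.X) :
    ∃ h : (1 / 2 : ℂ) • P.absTX x ∈ P.cayley.domain,
      P.cayley ⟨(1 / 2 : ℂ) • P.absTX x, h⟩ = P.FX x := by
  have e : (1 / 2 : ℂ) • P.absTX x = P.TX ((1 / 2 : ℂ) • P.phase x) := by
    rw [map_smul, TX_phase]
  have h : P.TX ((1 / 2 : ℂ) • P.phase x) ∈ P.cayley.domain := ⟨_, rfl⟩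
  refine ⟨e ▸ h, ?_⟩
  have : (⟨(1 / 2 : ℂ) • P.absTX x, e ▸ h⟩ : P.cayley.domain) =
      ⟨P.TX ((1 / 2 : ℂ) • P.phase x), h⟩ := Subtype.ext e
  rw [this, cayley_apply, map_smul, map_smul]
  rfl

lemma absTX_absTX (x : P.X) : P.absTX (P.absTX x) = -P.TX (P.TX x) := by
  refine Subtype.ext ?_
  have := congrArg (fun k : 𝓜(ℂ, A) => k.fst (x : A)) P.absT_mul_absT
  simpa [absTX, TX] using this

lemma TX_TX (x : P.X) : P.TX (P.TX x) = (-4 : ℂ) • x - P.SX (P.SX x) :=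
  eq_sub_of_add_eq (P.TX_TX_add_SX_SX x)

/-- `½ |J₁ - J₀| ⊗ 1 = (1 + (𝒞 ⊗ ρ)²)^{-1/2}` -/
noncomputable def R : Module.End ℂ P.module.carrier :=
  LinearMap.prodMap ((1 / 2 : ℂ) • P.absTX) ((1 / 2 : ℂ) • P.absTX)

lemma isInvSqrt_R : P.module.IsInvSqrtOnePlusSq (P.unboundedTensorρ P.cayley) P.R := by
  have hstar : ∀ x y : P.X, star (P.absTX x : A) * (y : A) = star (x : A) * (P.absTX y : A) := by
    intro x y
    change star (P.absT.fst x) * (y : A) = star (x : A) * P.absT.fst y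
    rw [DoubleCentralizer.star_fst_mul, P.star_absT]
  refine ⟨⟨fun x y => ?_, fun x => ?_⟩, fun x => ?_⟩
  · change star (((1 / 2 : ℂ) • P.absTX x.1 : P.X) : A) * (y.1 : A) +
      star (((1 / 2 : ℂ) • P.absTX x.2 : P.X) : A) * (y.2 : A) =
      star (x.1 : A) * (((1 / 2 : ℂ) • P.absTX y.1 : P.X) : A) +
      star (x.2 : A) * (((1 / 2 : ℂ) • P.absTX y.2 : P.X) : A)
    simp only [Submodule.coe_smul, star_smul, smul_mul_assoc, mul_smul_comm, hstar]
    simp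
  · obtain ⟨q, hq⟩ := P.absT_pos
    have hpos : ∀ x : P.X, star (((1 / 2 : ℂ) • P.absTX x : P.X) : A) * (x : A) =
        star ((Real.sqrt (1 / 2) : ℂ) • q.fst x) * ((Real.sqrt (1 / 2) : ℂ) • q.fst (x : A)) := by
      intro x
      have h1 : star (P.absT.fst (x : A)) * (x : A) = star (q.fst (x : A)) * q.fst (x : A) := by
        rw [DoubleCentralizer.star_fst_mul, DoubleCentralizer.star_fst_mul, P.star_absT, hq]
        rfl
      rw [star_smul, smul_mul_smul_comm, Submodule.coe_smul, star_smul, smul_mul_assoc]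
      change star (1 / 2 : ℂ) • (star (P.absT.fst (x : A)) * (x : A)) = _
      rw [h1]
      congr 1
      have : ((Real.sqrt (1 / 2) : ℝ) : ℂ) * ((Real.sqrt (1 / 2) : ℝ) : ℂ) = 1 / 2 := by
        rw [← Complex.ofReal_mul, Real.mul_self_sqrt (by norm_num)]; norm_num
      simpa using this.symm
    change ∃ b, star (((1 / 2 : ℂ) • P.absTX x.1 : P.X) : A) * (x.1 : A) +
      star (((1 / 2 : ℂ) • P.absTX x.2 : P.X) : A) * (x.2 : A) = star b * b
    rw [hpos, hpos]
    exact exists_star_mul_self_add _ _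
  · -- `R² = ¼ |T|²`, and `𝒞 R² = ½ F |T|`, `𝒞² R² = F²`
    have hc : ∀ y : P.X, ∃ (h₁ : (1 / 2 : ℂ) • P.absTX ((1 / 2 : ℂ) • P.absTX y) ∈ P.cayley.domain)
        (h₂ : P.cayley ⟨_, h₁⟩ ∈ P.cayley.domain),
        (1 / 2 : ℂ) • P.absTX ((1 / 2 : ℂ) • P.absTX y) - P.cayley ⟨P.cayley ⟨_, h₁⟩, h₂⟩ = y := by
      intro y
      obtain ⟨h₁, e₁⟩ := P.cayley_half_absTX ((1 / 2 : ℂ) • P.absTX y)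
      have e₂ : P.FX ((1 / 2 : ℂ) • P.absTX y) = P.TX (-(1 / 4 : ℂ) • P.J₁X (P.SX y)) := by
        rw [← TX_phase, FX_apply, map_smul, map_smul, map_smul]
        have h3 : P.phase (P.TX (P.phase y)) = P.TX (P.phase (P.phase y)) :=
          P.phase_restrict _ (P.act_mem_X rfl) rfl P.commute_T _
        have h4 : P.J₀X (P.SX (P.TX y)) = P.TX (P.J₁X (P.SX y)) := by
          refine Subtype.ext ?_
          have : P.J₀ * P.S * P.T = P.T * (P.J₁ * P.S) := by
            rw [mul_assoc, S_mul_T, ← mul_assoc, J₀_mul_T]; simp [mul_assoc]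
          have := congrArg (fun k : 𝓜(ℂ, A) => k.fst (y : A)) this
          simpa [J₀X, SX, TX, J₁X] using this
        rw [h3, phase_phase, map_neg, map_neg, map_neg, h4, map_smul, smul_smul, smul_neg,
          ← neg_smul]
        norm_num
      have h₂ : P.cayley ⟨_, h₁⟩ ∈ P.cayley.domain := by
        rw [e₁, e₂]; exact ⟨_, rfl⟩
      refine ⟨h₁, h₂, ?_⟩
      have h₃ : P.TX (-(1 / 4 : ℂ) • P.J₁X (P.SX y)) ∈ P.cayley.domain := ⟨_, rfl⟩
      have h₄ : (⟨P.cayley ⟨_, h₁⟩, h₂⟩ : P.cayley.domain) =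
          ⟨P.TX (-(1 / 4 : ℂ) • P.J₁X (P.SX y)), h₃⟩ := Subtype.ext (e₁.trans e₂)
      rw [h₄, cayley_apply, map_smul, map_smul, ← J₀X_SX, map_smul, J₀X_J₀X, absTX_absTX, TX_TX]
      module
    obtain ⟨h₁, h₂, e⟩ := hc x.1
    obtain ⟨h₁', h₂', e'⟩ := hc x.2
    refine ⟨⟨h₁, h₁'⟩, ⟨P.cayley.domain.neg_mem h₂', h₂⟩, ?_⟩
    refine Prod.ext ?_ ?_
    · change (1 / 2 : ℂ) • P.absTX ((1 / 2 : ℂ) • P.absTX x.1) + -P.cayley ⟨_, h₂⟩ = x.1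
      rw [← sub_eq_add_neg]; exact e
    · change (1 / 2 : ℂ) • P.absTX ((1 / 2 : ℂ) • P.absTX x.2) +
        P.cayley ⟨-P.cayley ⟨_, h₁'⟩, P.cayley.domain.neg_mem h₂'⟩ = x.2
      have : P.cayley ⟨-P.cayley ⟨_, h₁'⟩, P.cayley.domain.neg_mem h₂'⟩ = -P.cayley ⟨_, h₂'⟩ :=
        P.cayley.map_neg ⟨_, h₂'⟩
      rw [this, ← sub_eq_add_neg]
      exact e'

/-- `F` is the bounded transform of `𝒞_{J₀}(J₁) ⊗ ρ`. -/
theorem isBoundedTransform_F :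
    P.module.IsBoundedTransform (P.unboundedTensorρ P.cayley) P.F := by
  refine ⟨P.R, P.isInvSqrt_R, fun x => ?_⟩
  obtain ⟨h, e⟩ := P.cayley_half_absTX x.1
  obtain ⟨h', e'⟩ := P.cayley_half_absTX x.2
  refine ⟨⟨h, h'⟩, Prod.ext ?_ ?_⟩
  · change -P.FX x.2 = -P.cayley ⟨_, h'⟩
    rw [← e']
  · exact e.symm

lemma oneγ_sq : P.oneγ * P.oneγ = 1 := rfl

lemma J₀ρ_sq : P.tensorρ P.J₀X * P.tensorρ P.J₀X = 1 := by
  refine LinearMap.ext fun x => Prod.ext ?_ ?_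
  · change -P.J₀X (P.J₀X x.1) = x.1
    rw [J₀X_J₀X, neg_neg]
  · change P.J₀X (-P.J₀X x.2) = x.2
    rw [map_neg, J₀X_J₀X, neg_neg]

lemma oneγ_mul_tensorρ (L : P.X →ₗ[ℂ] P.X) :
    P.oneγ * P.tensorρ L = -(P.tensorρ L * P.oneγ) := by
  refine LinearMap.ext fun x => Prod.ext ?_ ?_
  · change L x.1 = - -L x.1
    rw [neg_neg]
  · rfl

/-- The left action of `ℂℓ_{2,0}` on `X ⊗ ⋀* ℂ` with generators `1 ⊗ γ` and `J₀ ⊗ ρ`. -/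
noncomputable def π : Cl20 →ₙₐ[ℂ] Module.End ℂ P.module.carrier :=
  Cl20.lift P.oneγ (P.tensorρ P.J₀X) P.oneγ_sq P.J₀ρ_sq (P.oneγ_mul_tensorρ _)

lemma π_apply (m : Cl20) (x : P.module.carrier) : P.π m x =
    (((m 0 0 + m 1 1) / 2) • x.1 + ((m 0 1 + m 1 0) / 2) • x.2 -
      ((m 0 0 - m 1 1) / 2) • P.J₀X x.2 + ((m 1 0 - m 0 1) / 2) • P.J₀X x.1,
     ((m 0 0 + m 1 1) / 2) • x.2 + ((m 0 1 + m 1 0) / 2) • x.1 +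
      ((m 0 0 - m 1 1) / 2) • P.J₀X x.1 - ((m 1 0 - m 0 1) / 2) • P.J₀X x.2) := by
  refine Prod.ext ?_ ?_
  · change ((m 0 0 + m 1 1) / 2) • x.1 + ((m 0 1 + m 1 0) / 2) • x.2 +
      ((m 0 0 - m 1 1) / 2) • (-P.J₀X x.2) + ((m 1 0 - m 0 1) / 2) • P.J₀X x.1 = _
    module
  · change ((m 0 0 + m 1 1) / 2) • x.2 + ((m 0 1 + m 1 0) / 2) • x.1 +
      ((m 0 0 - m 1 1) / 2) • P.J₀X x.1 + ((m 1 0 - m 0 1) / 2) • (-P.J₀X x.2) = _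
    module

lemma F_apply (x : P.module.carrier) : P.F x = (-P.FX x.2, P.FX x.1) := rfl

lemma exists_generator : ∃ a : P.X, ∀ c : A, P.T.fst c = a * c := by
  obtain ⟨a, ha⟩ := P.sub_mem
  have hT : ∀ c, P.T.fst c = a * c := fun c => by
    rw [T, ← ha]; rfl
  refine ⟨⟨a, ?_⟩, hT⟩
  change a ∈ (P.X : Set A)
  rw [← P.isClosed_X.closure_eq, Metric.mem_closure_iff]
  intro ε hε
  obtain ⟨u, hu⟩ := mem_closure_mul a ε hε
  exact ⟨a * u, hT u ▸ P.T_mem_X u, by rwa [dist_eq_norm]⟩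

lemma nrm_le (x : P.module.carrier) : P.module.nrm x ≤ ‖x.1‖ + ‖x.2‖ := by
  refine Real.sqrt_le_iff.mpr ⟨by positivity, (norm_add_le_norm_sq (x.1 : A) x.2).trans ?_⟩
  have h1 : (0 : ℝ) ≤ ‖(x.1 : A)‖ * ‖(x.2 : A)‖ := by positivity
  change ‖(x.1 : A)‖ ^ 2 + ‖(x.2 : A)‖ ^ 2 ≤ (‖(x.1 : A)‖ + ‖(x.2 : A)‖) ^ 2
  nlinarith

lemma countablyGenerated : P.module.CountablyGenerated := by
  obtain ⟨a, ha⟩ := P.exists_generator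
  refine ⟨fun n => if n = 0 then (a, 0) else (0, a), fun x ε hε => ?_⟩
  obtain ⟨c, hc⟩ := Metric.denseRange_iff.mp P.denseRange_toX x.1 (ε / 2) (by positivity)
  obtain ⟨d, hd⟩ := Metric.denseRange_iff.mp P.denseRange_toX x.2 (ε / 2) (by positivity)
  refine ⟨(P.toX c, P.toX d), ?_, ?_⟩
  · have e : ((P.toX c, P.toX d) : P.module.carrier) =
        P.module.rsmul (a, 0) c + P.module.rsmul (0, a) d := by
      refine Prod.ext (Subtype.ext ?_) (Subtype.ext ?_)
      · change P.T.fst c = (a : A) * c + 0 * d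
        rw [ha, zero_mul, add_zero]
      · change P.T.fst d = 0 * c + (a : A) * d
        rw [ha, zero_mul, zero_add]
    rw [e]
    exact Submodule.add_mem _ (Submodule.subset_span ⟨0, c, rfl⟩)
      (Submodule.subset_span ⟨1, d, rfl⟩)
  · refine (P.nrm_le _).trans_lt ?_
    rw [dist_eq_norm] at hc hd
    change ‖x.1 - P.toX c‖ + ‖x.2 - P.toX d‖ < ε
    linarith

lemma one_sub_F_sq (x : P.module.carrier) :
    (1 - P.F * P.F) x = (-(1 / 4 : ℂ) • P.TX (P.TX x.1), -(1 / 4 : ℂ) • P.TX (P.TX x.2)) := by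
  have h : ∀ u : P.X, u - -P.FX (P.FX u) = -(1 / 4 : ℂ) • P.TX (P.TX u) := fun u => by
    rw [FX_FX, TX_TX]; module
  refine Prod.ext (h x.1) ?_
  change x.2 - P.FX (-P.FX x.2) = _
  rw [map_neg]
  exact h x.2

lemma star_π (m : Cl20) (x y : P.module.carrier) :
    P.module.inner (P.π m x) y = P.module.inner x (P.π (star m) y) := by
  rw [π_apply, π_apply]
  have h := P.inner_J₀X
  have h' : ∀ u v : P.X, star (u : A) * (P.J₀X v : A) = -(star (P.J₀X u : A) * (v : A)) :=
    fun u v => by rw [h, neg_neg]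
  change star (Subtype.val _) * (y.1 : A) + star (Subtype.val _) * (y.2 : A) =
    star (x.1 : A) * Subtype.val _ + star (x.2 : A) * Subtype.val _
  simp only [Submodule.coe_add, Submodule.coe_sub, Submodule.coe_smul, star_add, star_sub,
    star_smul, add_mul, sub_mul, mul_add, mul_sub, smul_mul_assoc, mul_smul_comm, h',
    CStarMatrix.star_apply]
  simp only [star_add, star_sub, star_div₀, star_ofNat]
  module

lemma conj_π (m : Cl20) (x : P.module.carrier) :
    P.π (conj m) (P.module.conj x) = P.module.conj (P.π m x) := by
  have hJ : ∀ u : P.X, (P.J₀X ⟨conj (u : A), P.conj_mem_X u u.2⟩ : A) = conj (P.J₀X u : A) :=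
    fun u => conj_restrict P.J₀ P.h₀.real u
  have hsub : ∀ a b : A, conj (a - b) = conj a - conj b := (conjₗᵢ A).map_sub
  rw [π_apply, π_apply]
  refine Prod.ext (Subtype.ext ?_) (Subtype.ext ?_)
  · change Subtype.val _ = conj (Subtype.val _)
    simp only [Submodule.coe_add, Submodule.coe_sub, Submodule.coe_smul, conj_add, hsub, conj_smul,
      ← hJ, star_div₀, star_add, star_sub, star_ofNat]
    rfl
  · change Subtype.val _ = conj (Subtype.val _)
    simp only [Submodule.coe_add, Submodule.coe_sub, Submodule.coe_smul, conj_add, hsub, conj_smul,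
      ← hJ, star_div₀, star_add, star_sub, star_ofNat]
    rfl

lemma parity_π (m : Cl20) (x : P.module.carrier) :
    P.π (parity m) (P.module.parity x) = P.module.parity (P.π m x) := by
  rw [π_apply, π_apply]
  refine Prod.ext ?_ ?_
  · change ((m 1 1 + m 0 0) / 2) • x.1 + ((-m 1 0 + -m 0 1) / 2) • (-x.2) -
      ((m 1 1 - m 0 0) / 2) • P.J₀X (-x.2) + ((-m 0 1 - -m 1 0) / 2) • P.J₀X x.1 = _ - _ + _
    rw [map_neg]; module
  · change ((m 1 1 + m 0 0) / 2) • (-x.2) + ((-m 1 0 + -m 0 1) / 2) • x.1 +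
      ((m 1 1 - m 0 0) / 2) • P.J₀X x.1 - ((-m 0 1 - -m 1 0) / 2) • P.J₀X (-x.2) = -(_ + _ - _)
    rw [map_neg]; module

lemma F_mul_π (m : Cl20) : P.F * P.π m - P.π (parity m) * P.F = 0 := by
  rw [sub_eq_zero]
  refine LinearMap.ext fun x => ?_
  change P.F (P.π m x) = P.π (parity m) (P.F x)
  rw [π_apply, π_apply]
  refine Prod.ext ?_ ?_
  · change -P.FX (_ + _ + _ - _) = ((m 1 1 + m 0 0) / 2) • (-P.FX x.2) +
      ((-m 1 0 + -m 0 1) / 2) • (P.FX x.1) -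
      ((m 1 1 - m 0 0) / 2) • P.J₀X (P.FX x.1) + ((-m 0 1 - -m 1 0) / 2) • P.J₀X (-P.FX x.2)
    simp only [map_add, map_sub, map_smul, FX_J₀X, map_neg]
    module
  · change P.FX (_ + _ - _ + _) = ((m 1 1 + m 0 0) / 2) • (P.FX x.1) +
      ((-m 1 0 + -m 0 1) / 2) • (-P.FX x.2) +
      ((m 1 1 - m 0 0) / 2) • P.J₀X (-P.FX x.2) - ((-m 0 1 - -m 1 0) / 2) • P.J₀X (P.FX x.1)
    simp only [map_add, map_sub, map_smul, FX_J₀X, map_neg]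
    module

lemma nrm_zero : P.module.nrm 0 = 0 :=
  le_antisymm ((P.nrm_le 0).trans (by change ‖(0 : P.X)‖ + ‖(0 : P.X)‖ ≤ 0; simp))
    (Real.sqrt_nonneg _)

/-- `1 - F²` is the sum of two rank-one operators, so `π(m) (1 - F²)` is compact. -/
lemma sq_compact (m : Cl20) : P.module.IsCompactEnd (P.π m * (1 - P.F * P.F)) := by
  obtain ⟨a, ha⟩ := P.exists_generator
  intro ε hε
  refine ⟨2, ![P.π m ((1 / 4 : ℂ) • ((a, 0) : P.X × P.X)),
    P.π m ((1 / 4 : ℂ) • ((0, a) : P.X × P.X))],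
    ![((a, 0) : P.X × P.X), ((0, a) : P.X × P.X)], fun z => ?_⟩
  have hT : ∀ c : A, star (P.T.fst c) = star c * star (a : A) := fun c => by rw [ha]; simp
  have hTs : ∀ c : A, P.T.fst c = -(star (a : A) * c) := fun c => by
    have key : ∀ d : A, star d * (P.T.fst c + star (a : A) * c) = 0 := fun d => by
      have h1 := DoubleCentralizer.star_fst_mul P.T d c
      rw [P.star_T, DoubleCentralizer.neg_fst, hT] at h1
      rw [mul_add, ← mul_assoc, h1]
      simp
    have := key (P.T.fst c + star (a : A) * c)
    rw [CStarRing.star_mul_self_eq_zero_iff] at this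
    exact eq_neg_of_add_eq_zero_left this
  have hTT : ∀ u : P.X, -(1 / 4 : ℂ) • P.TX (P.TX u) =
      (1 / 4 : ℂ) • (⟨(a : A) * (star (a : A) * u), P.mul_mem_X a a.2 _⟩ : P.X) := fun u => by
    refine Subtype.ext ?_
    change -(1 / 4 : ℂ) • P.T.fst (P.T.fst (u : A)) = (1 / 4 : ℂ) • ((a : A) * (star (a : A) * u))
    rw [ha, hTs]; simp
  have hπ : ∀ (k : Cl20) (x : P.module.carrier) (b : A),
      P.π k (P.module.rsmul x b) = P.module.rsmul (P.π k x) b := fun k x b => by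
    have hJ : ∀ (u : P.X) (h : (u : A) * b ∈ P.X),
        (P.J₀X ⟨(u : A) * b, h⟩ : A) = (P.J₀X u : A) * b :=
      fun u _ => DoubleCentralizer.fst_mul _ _ _
    rw [π_apply, π_apply]
    refine Prod.ext (Subtype.ext ?_) (Subtype.ext ?_)
    · change Subtype.val _ = Subtype.val _ * b
      simp only [Submodule.coe_add, Submodule.coe_sub, Submodule.coe_smul, add_mul, sub_mul,
        smul_mul_assoc, ← hJ _ (P.mul_mem_X _ (Subtype.prop _) _)]
      rfl
    · change Subtype.val _ = Subtype.val _ * b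
      simp only [Submodule.coe_add, Submodule.coe_sub, Submodule.coe_smul, add_mul, sub_mul,
        smul_mul_assoc, ← hJ _ (P.mul_mem_X _ (Subtype.prop _) _)]
      rfl
  have e : (1 - P.F * P.F) z =
      P.module.rsmul ((1 / 4 : ℂ) • ((a, 0) : P.X × P.X))
        (P.module.inner ((a, 0) : P.X × P.X) z) +
      P.module.rsmul ((1 / 4 : ℂ) • ((0, a) : P.X × P.X))
        (P.module.inner ((0, a) : P.X × P.X) z) := by
    rw [one_sub_F_sq, hTT, hTT]
    refine Prod.ext (Subtype.ext ?_) (Subtype.ext ?_)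
    · change (1 / 4 : ℂ) • ((a : A) * (star (a : A) * z.1)) =
        ((1 / 4 : ℂ) • (a : A)) * (star (a : A) * z.1 + star (0 : A) * z.2) +
        ((1 / 4 : ℂ) • (0 : A)) * (star (0 : A) * z.1 + star (a : A) * z.2)
      simp [smul_mul_assoc]
    · change (1 / 4 : ℂ) • ((a : A) * (star (a : A) * z.2)) =
        ((1 / 4 : ℂ) • (0 : A)) * (star (a : A) * z.1 + star (0 : A) * z.2) +
        ((1 / 4 : ℂ) • (a : A)) * (star (0 : A) * z.1 + star (a : A) * z.2)
      simp [smul_mul_assoc]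
  have e' : (P.π m * (1 - P.F * P.F)) z =
      P.module.rsmul (P.π m ((1 / 4 : ℂ) • ((a, 0) : P.X × P.X)))
        (P.module.inner ((a, 0) : P.X × P.X) z) +
      P.module.rsmul (P.π m ((1 / 4 : ℂ) • ((0, a) : P.X × P.X)))
        (P.module.inner ((0, a) : P.X × P.X) z) :=
    (congrArg (P.π m) e).trans ((map_add (P.π m) _ _).trans
      (congrArg₂ (· + ·) (hπ m _ _) (hπ m _ _)))
  rw [e', Fin.sum_univ_two]
  refine le_of_eq_of_le ?_ (mul_nonneg hε.le (Real.sqrt_nonneg _) : 0 ≤ ε * P.module.nrm z)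
  refine (congrArg P.module.nrm ?_).trans P.nrm_zero
  exact sub_self _

/-- The Real Kasparov module `(ℂℓ_{2,0}, X ⊗ ⋀* ℂ, F)`, where `F` is the bounded transform of
`𝒞_{J₀}(J₁) ⊗ ρ` and `ℂℓ_{2,0}` acts through the generators `1 ⊗ γ` and `J₀ ⊗ ρ`. -/
noncomputable def kasparovModule : KasparovModule Cl20 A where
  E := P.module
  countablyGenerated := P.countablyGenerated
  π := P.π
  inner_π := P.star_π
  π_conj := P.conj_π
  π_parity := P.parity_π
  F := P.F
  F_selfAdj x y := by
    change star (((-P.FX x.2 : P.X)) : A) * (y.1 : A) + star (P.FX x.1 : A) * (y.2 : A) =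
      star (x.1 : A) * ((-P.FX y.2 : P.X) : A) + star (x.2 : A) * (P.FX y.1 : A)
    simp only [Submodule.coe_neg, star_neg, neg_mul, mul_neg, inner_FX, neg_neg]
    rw [add_comm]
  F_conj x := by
    refine Prod.ext (Subtype.ext ?_) (Subtype.ext (P.conj_FX x.1))
    change -(P.FX ⟨conj (x.2 : A), P.conj_mem_X _ x.2.2⟩ : A) = conj (-(P.FX x.2 : A))
    rw [conj_FX, conj_neg]
  F_odd x := by
    refine Prod.ext ?_ ?_
    · change -P.FX (-x.2) = - -P.FX x.2
      rw [map_neg]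
    · change P.FX x.1 = - -P.FX x.1
      rw [neg_neg]
  comm_compact m ε hε := by
    refine ⟨0, Fin.elim0, Fin.elim0, fun z => ?_⟩
    rw [F_mul_π]
    refine le_of_eq_of_le ?_ (mul_nonneg hε.le (Real.sqrt_nonneg _) : 0 ≤ ε * P.module.nrm z)
    refine (congrArg P.module.nrm ?_).trans P.nrm_zero
    simp
  sq_compact := P.sq_compact

/-- The class `[𝒞_{J₀}(J₁)] ∈ KKR(ℂℓ_{2,0}, A)`. -/
noncomputable def cayleyClass : KKR Cl20 A := KKR.mk P.kasparovModule

end LocalPair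

/-! ### Continuous paths of multipliers -/

section pathMultiplier

variable {A : Type u} [NonUnitalCStarAlgebra A]

/-! The homotopy is the Cayley construction itself, carried out over `C([0,1], A)`. A
norm-continuous path `J` acts pointwise on `C([0,1], A)` and so is a single Real skew-adjoint
unitary multiplier of that algebra; the constant path `J 0` is another. Since `A` embeds
isometrically in its multiplier algebra, the elements of `A` representing `J t - J 0` depend
continuously on `t`, so the difference of the two multipliers lies in `C([0,1], A)`. Thus the two
form a `LocalPair` over `C([0,1], A)`, and `kasparovModule` supplies a Kasparov module over it, with
every compactness condition already verified.

It remains to identify its ends. At time `0` the operator `J t - J 0` vanishes, hence so does every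
element of the ideal `X`, and the evaluation is the zero module. At time `1` it is the module of the
pair `(J 0, J 1)`. This needs two facts. First, evaluation maps the ideal of the path onto the ideal
of the fibre (`evalX_surjective`); the fibre ideals vary with `t`, and surjectivity, rather than
mere density of the image, comes from norm-controlled lifts of a dense subspace. Second, evaluation
intertwines the bounded transforms (`evalX_FX`). These are `½ J₀ (J₁ + J₀)` composed with the phase,
where the phase extends `(J₁ - J₀) c ↦ |J₁ - J₀| c`; so it suffices that absolute values are
computed pointwise (`path_absT_fst_apply`), which is uniqueness of positive square roots. No
continuity of the unbounded Cayley transforms enters. -/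

lemma DoubleCentralizer.continuous_fst : Continuous fun m : 𝓜(ℂ, A) => m.fst :=
  (AddMonoidHomClass.isometry_of_norm
    (AddMonoidHom.mk' (fun m : 𝓜(ℂ, A) => m.fst) DoubleCentralizer.add_fst)
    DoubleCentralizer.norm_fst).continuous

lemma DoubleCentralizer.continuous_snd : Continuous fun m : 𝓜(ℂ, A) => m.snd :=
  (AddMonoidHomClass.isometry_of_norm
    (AddMonoidHom.mk' (fun m : 𝓜(ℂ, A) => m.snd) DoubleCentralizer.add_snd)
    DoubleCentralizer.norm_snd).continuous

/-- The multiplier norm of `a` is the operator norm of left multiplication by `a`, which in a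
C*-algebra equals `‖a‖`. -/
lemma DoubleCentralizer.isometry_coe : Isometry (DoubleCentralizer.coe ℂ : A → 𝓜(ℂ, A)) := by
  refine AddMonoidHomClass.isometry_of_norm (DoubleCentralizer.coeHom (𝕜 := ℂ) (A := A)) fun a => ?_
  change ‖(a : 𝓜(ℂ, A))‖ = ‖a‖
  rw [← DoubleCentralizer.norm_fst, DoubleCentralizer.coe_fst]
  exact (ContinuousLinearMap.isometry_mul ℂ A).norm_map_of_map_zero (map_zero _) a

/-- An isometry is an embedding, so the pointwise chosen elements of `A` form a continuous path as
soon as their images in `𝓜(ℂ, A)` do, and these images are `J t - J 0`. -/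
lemma DoubleCentralizer.exists_path_coe_eq_sub (J : C(I, 𝓜(ℂ, A)))
    (hloc : ∀ t, J t - J 0 ∈ Set.range (DoubleCentralizer.coe ℂ : A → 𝓜(ℂ, A))) :
    ∃ a : C(I, A), ∀ t, (DoubleCentralizer.coe ℂ (a t) : 𝓜(ℂ, A)) = J t - J 0 := by
  choose a ha using hloc
  refine ⟨⟨a, DoubleCentralizer.isometry_coe.isEmbedding.continuous_iff.mpr ?_⟩, ha⟩
  exact (J.continuous.sub continuous_const).congr fun t => (ha t).symm

/-- A continuous path of operators on `A` acts pointwise on `C([0,1], A)`. -/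
noncomputable def pathOperator (L : C(I, A →L[ℂ] A)) : C(I, A) →L[ℂ] C(I, A) :=
  LinearMap.mkContinuous
    -- Norm continuity of `L` makes `t ↦ L t (f t)` continuous for every continuous `f`.
    { toFun := fun f => ⟨fun t => L t (f t), L.continuous.clm_apply f.continuous⟩
      map_add' := fun f g => by ext t; simp
      map_smul' := fun z f => by ext t; simp } ‖L‖ fun f => by
    rw [ContinuousMap.norm_le _ (by positivity)]
    exact fun t => (L t).le_of_opNorm_le_of_le (L.norm_coe_le_norm t) (f.norm_coe_le_norm t)

/-- A norm-continuous path of multipliers of `A`, as a multiplier of `C([0,1], A)`. -/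
noncomputable def pathMultiplier (m : C(I, 𝓜(ℂ, A))) : 𝓜(ℂ, C(I, A)) where
  fst := pathOperator ⟨fun t => (m t).fst, DoubleCentralizer.continuous_fst.comp m.continuous⟩
  snd := pathOperator ⟨fun t => (m t).snd, DoubleCentralizer.continuous_snd.comp m.continuous⟩
  central f g := by ext t; exact (m t).central (f t) (g t)

/-- Multipliers of `C([0,1], A)` are equal if they act by the same operators at all times. -/
lemma DoubleCentralizer.path_ext {m n : 𝓜(ℂ, C(I, A))} (h₁ : ∀ f t, m.fst f t = n.fst f t)
    (h₂ : ∀ f t, m.snd f t = n.snd f t) : m = n :=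
  DoubleCentralizer.ext ℂ _ _ _ <| Prod.ext
    (ContinuousLinearMap.ext fun f => ContinuousMap.ext (h₁ f))
    (ContinuousLinearMap.ext fun f => ContinuousMap.ext (h₂ f))

/-- This and the next four identities hold by definition, both sides acting by the same operators at
each time. They carry the algebraic relations, and positivity in the form `star q * q`, from paths
of multipliers to multipliers of `C([0,1], A)`. -/
lemma pathMultiplier_one : pathMultiplier (1 : C(I, 𝓜(ℂ, A))) = 1 :=
  DoubleCentralizer.path_ext (fun _ _ => rfl) fun _ _ => rfl

lemma pathMultiplier_neg (m : C(I, 𝓜(ℂ, A))) : pathMultiplier (-m) = -pathMultiplier m :=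
  DoubleCentralizer.path_ext (fun _ _ => rfl) fun _ _ => rfl

lemma pathMultiplier_sub (m n : C(I, 𝓜(ℂ, A))) :
    pathMultiplier (m - n) = pathMultiplier m - pathMultiplier n :=
  DoubleCentralizer.path_ext (fun _ _ => rfl) fun _ _ => rfl

lemma pathMultiplier_mul (m n : C(I, 𝓜(ℂ, A))) :
    pathMultiplier (m * n) = pathMultiplier m * pathMultiplier n :=
  DoubleCentralizer.path_ext (fun _ _ => rfl) fun _ _ => rfl

lemma pathMultiplier_star (m : C(I, 𝓜(ℂ, A))) :
    pathMultiplier (star m) = star (pathMultiplier m) :=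
  DoubleCentralizer.path_ext (fun _ _ => rfl) fun _ _ => rfl

variable [GradedRealCStarAlgebra A]

/-- The Real structure of `C([0,1], A)` is pointwise, so Reality is tested at each time; skewness
and unitarity are identities in `C([0,1], 𝓜(ℂ, A))` transported by `pathMultiplier`. -/
lemma IsRealSkewUnitary.pathMultiplier {J : C(I, 𝓜(ℂ, A))} (hJ : ∀ t, IsRealSkewUnitary (J t)) :
    IsRealSkewUnitary (pathMultiplier J) where
  real := by
    refine DoubleCentralizer.path_ext (fun f t => ?_) fun f t => ?_
    · exact congrArg (fun m : 𝓜(ℂ, A) => m.fst (f t)) (hJ t).real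
    · exact congrArg (fun m : 𝓜(ℂ, A) => m.snd (f t)) (hJ t).real
  skew := by
    rw [← pathMultiplier_star, ← pathMultiplier_neg]
    exact congrArg _ (ContinuousMap.ext fun t => (hJ t).skew)
  unitary := by
    rw [Unitary.mem_iff, ← pathMultiplier_star, ← pathMultiplier_mul, ← pathMultiplier_mul,
      ← pathMultiplier_one]
    exact ⟨congrArg _ (ContinuousMap.ext fun t => (Unitary.mem_iff.mp (hJ t).unitary).1),
      congrArg _ (ContinuousMap.ext fun t => (Unitary.mem_iff.mp (hJ t).unitary).2)⟩

end pathMultiplier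

/-! ### The pair over `C([0,1], A)` and its fibres -/

namespace LocalPair

variable {A : Type u} [NonUnitalCStarAlgebra A] [GradedRealCStarAlgebra A]
  (htriv : TriviallyGraded A) (J : C(I, 𝓜(ℂ, A))) (hJ : ∀ t, IsRealSkewUnitary (J t))
  (hloc : ∀ t, J t - J 0 ∈ Set.range (DoubleCentralizer.coe ℂ : A → 𝓜(ℂ, A)))

/-- The pair `(J₀, J_t)`. -/
noncomputable def fiber (t : I) : LocalPair A := ⟨htriv, J 0, J t, hJ 0, hJ t, hloc t⟩

/-- The pair over `C([0,1], A)` consisting of the constant path `J₀` and the path `J`. -/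
noncomputable def path : LocalPair C(I, A) where
  triviallyGraded f := ContinuousMap.ext fun t => htriv (f t)
  J₀ := pathMultiplier (ContinuousMap.const I (J 0))
  J₁ := pathMultiplier J
  h₀ := .pathMultiplier fun _ => hJ 0
  h₁ := .pathMultiplier hJ
  sub_mem := by
    obtain ⟨a, ha⟩ := DoubleCentralizer.exists_path_coe_eq_sub J hloc
    -- Multiplication by the path `a` agrees at each time with the action of `J t - J 0`.
    refine ⟨a, DoubleCentralizer.path_ext (fun f t => ?_) fun f t => ?_⟩
    · exact congrArg (fun m : 𝓜(ℂ, A) => m.fst (f t)) (ha t)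
    · exact congrArg (fun m : 𝓜(ℂ, A) => m.snd (f t)) (ha t)

local notation "𝐏" => path htriv J hJ hloc
local notation "𝐅" => fiber htriv J hJ hloc

/-- The absolute value `h` of `J - J 0` is taken in the C*-algebra `C([0,1], 𝓜(ℂ, A))`. Both
`pathMultiplier` and evaluation at `t` preserve its square and its form `star q * q`, so
`absT_unique` identifies one image with the absolute value over `C([0,1], A)` and the other with
that of the fibre. -/
lemma path_absT_fst_apply (f : C(I, A)) (t : I) : (𝐏).absT.fst f t = (𝐅 t).absT.fst (f t) := by
  obtain ⟨h, ⟨q, hq⟩, hh, -⟩ := exists_absolute_value (J - ContinuousMap.const I (J 0))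
  have hT : (𝐏).T = pathMultiplier (J - ContinuousMap.const I (J 0)) :=
    (pathMultiplier_sub _ _).symm
  have e : pathMultiplier h = (𝐏).absT := by
    refine (𝐏).absT_unique _ (pathMultiplier q) ?_ ?_
    · rw [hq, pathMultiplier_mul, pathMultiplier_star]
    · rw [← neg_mul, ← star_T, hT, ← pathMultiplier_mul, hh, pathMultiplier_mul,
        pathMultiplier_star]
  have e' : h t = (𝐅 t).absT := by
    refine (𝐅 t).absT_unique _ (q t) (congrArg (fun m : C(I, 𝓜(ℂ, A)) => m t) hq) ?_
    rw [← neg_mul, ← star_T]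
    exact congrArg (fun m : C(I, 𝓜(ℂ, A)) => m t) hh
  rw [← e, ← e']
  rfl

/-! ### Evaluation on the ideals and the bounded transforms -/

lemma path_apply_mem (t : I) (f : C(I, A)) (hf : f ∈ (𝐏).X) : f t ∈ (𝐅 t).X :=
  (𝐏).induction_X ((𝐅 t).isClosed_X.preimage (continuous_eval_const t))
    (fun c => (𝐅 t).T_mem_X (c t)) f hf

/-- Evaluation at time `t` as a map between the Hilbert modules `X`. -/
noncomputable def evalX (t : I) : (𝐏).X →ₗ[ℂ] (𝐅 t).X where
  toFun x := ⟨(x : C(I, A)) t, path_apply_mem htriv J hJ hloc t x x.2⟩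
  map_add' _ _ := rfl
  map_smul' _ _ := rfl

local notation "𝐞" => evalX htriv J hJ hloc

lemma continuous_evalX (t : I) : Continuous (𝐞 t) :=
  ((continuous_eval_const t).comp continuous_subtype_val).subtype_mk _

lemma evalX_toX (t : I) (f : C(I, A)) : 𝐞 t ((𝐏).toX f) = (𝐅 t).toX (f t) := rfl

/-- Multipliers of the path act pointwise, so evaluation commutes with them by definition. The phase
is a continuous extension from a dense subspace and needs an argument of its own. -/
lemma evalX_J₀X (t : I) (x : (𝐏).X) : 𝐞 t ((𝐏).J₀X x) = (𝐅 t).J₀X (𝐞 t x) := rfl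

lemma evalX_SX (t : I) (x : (𝐏).X) : 𝐞 t ((𝐏).SX x) = (𝐅 t).SX (𝐞 t x) := rfl

/-- Both sides are continuous in `x`, so it is enough to compare them on the dense range of `toX`,
where the phase is given by the absolute value. -/
lemma evalX_phase (t : I) (x : (𝐏).X) : 𝐞 t ((𝐏).phase x) = (𝐅 t).phase (𝐞 t x) := by
  revert x
  have hc := continuous_evalX htriv J hJ hloc t
  refine (𝐏).induction_toX (isClosed_eq (hc.comp (𝐏).phase.continuous)
    ((𝐅 t).phase.continuous.comp hc)) fun f => ?_
  rw [phase_toX, evalX_toX, phase_toX]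
  exact Subtype.ext (path_absT_fst_apply htriv J hJ hloc f t)

lemma evalX_FX (t : I) (x : (𝐏).X) : 𝐞 t ((𝐏).FX x) = (𝐅 t).FX (𝐞 t x) := by
  rw [FX_apply, FX_apply, map_smul, evalX_J₀X, evalX_SX, evalX_phase]

/-! ### Surjectivity of evaluation -/

/-- Every `(J_t - J₀) c` is the value at `t` of an element of the module over `C([0,1], A)` of at
most the same norm. -/
lemma exists_lift_toX (t : I) (c : A) :
    ∃ x : (𝐏).X, 𝐞 t x = (𝐅 t).toX c ∧ ‖x‖ ≤ ‖(𝐅 t).toX c‖ := by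
  set r := ‖(𝐅 t).toX c‖ with hr
  -- If `r = 0` the rescaling below may divide by zero, but then the element to be lifted is `0`.
  rcases eq_or_ne r 0 with h0 | h0
  · exact ⟨0, ((map_zero _).trans (norm_eq_zero.mp h0).symm), by simp [h0]⟩
  have hr0 : 0 < r := lt_of_le_of_ne (norm_nonneg _) h0.symm
  let g : C(I, A) := (𝐏).T.fst (ContinuousMap.const I c)
  have hgt : ‖g t‖ = r := rfl
  have hpos : ∀ s, 0 < max r ‖g s‖ := fun s => hr0.trans_le (le_max_left _ _)
  -- The constant path `c` would lift the element, but `‖(J s - J 0) c‖` may exceed `r` at other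
  -- times. The factor `r / max r ‖g s‖` equals `1` at `s = t` and reduces the norm to at most `r`
  -- everywhere.
  let φ : C(I, A) := ⟨fun s => ((r / max r ‖g s‖ : ℝ) : ℂ) • c, by
    have : Continuous fun s => r / max r ‖g s‖ :=
      continuous_const.div (continuous_const.max g.continuous.norm) fun s => (hpos s).ne'
    fun_prop⟩
  have hφ : ∀ s, (𝐏).T.fst φ s = ((r / max r ‖g s‖ : ℝ) : ℂ) • g s := fun s =>
    map_smul (𝐅 s).T.fst _ c
  refine ⟨(𝐏).toX φ, Subtype.ext ?_, ?_⟩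
  · refine (hφ t).trans ?_
    rw [hgt, max_self, div_self h0, Complex.ofReal_one, one_smul]
    rfl
  · refine (ContinuousMap.norm_le _ hr0.le).mpr fun s => ?_
    change ‖(𝐏).T.fst φ s‖ ≤ r
    rw [hφ, norm_smul, Complex.norm_real, Real.norm_of_nonneg (div_nonneg hr0.le (hpos s).le),
      div_mul_eq_mul_div, div_le_iff₀ (hpos s)]
    gcongr
    exact le_max_right _ _

lemma evalX_surjective (t : I) : Function.Surjective (𝐞 t) := by
  let f : NormedAddGroupHom (𝐏).X (𝐅 t).X :=
    AddMonoidHom.mkNormedAddGroupHom (𝐞 t).toAddMonoidHom 1 fun x => by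
      rw [one_mul]
      exact (x : C(I, A)).norm_coe_le_norm t
  -- The range of `toX` is lifted with constant `1`; by completeness a series of such lifts reaches
  -- its closure, which is all of the fibre ideal. The resulting constant `1 + 1` plays no role.
  have h := controlled_closure_of_complete (f := f)
    (K := (𝐅 t).toX.toAddMonoidHom.range) one_pos one_pos (by
      rintro _ ⟨c, rfl⟩
      obtain ⟨x, hx, hn⟩ := exists_lift_toX htriv J hJ hloc t c
      exact ⟨x, hx, by rwa [one_mul]⟩)
  intro y
  obtain ⟨x, hx, -⟩ := h y ((𝐅 t).denseRange_toX y)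
  exact ⟨x, hx⟩

/-! ### The homotopy and the vanishing of the class -/

/-- The Kasparov module of the pair over `C([0,1], A)` evaluates at `t` to that of `(J₀, J_t)`. -/
theorem isEvaluation_fiber (t : I) :
    KasparovModule.IsEvaluation t (𝐏).kasparovModule (𝐅 t).kasparovModule := by
  -- Inner product, right action, Real structure and left Clifford action are pointwise, hence match
  -- by definition. The parity and `F` involve a sign on one summand, and `F` also requires
  -- `evalX_FX`.
  refine ⟨LinearMap.prodMap (𝐞 t) (𝐞 t), ?_, fun _ _ => rfl, fun _ _ => rfl, fun _ => rfl,
    fun x => ?_, fun m x => ?_, fun x => ?_⟩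
  · exact (evalX_surjective htriv J hJ hloc t).prodMap (evalX_surjective htriv J hJ hloc t)
  · exact Prod.ext rfl (map_neg (𝐞 t) _)
  · rfl
  · refine Prod.ext ?_ (evalX_FX htriv J hJ hloc t x.1)
    exact (map_neg (𝐞 t) _).trans (congrArg Neg.neg (evalX_FX htriv J hJ hloc t x.2))

/-- The Kasparov module of the pair over `C([0,1], A)` evaluates at `0` to the zero module. -/
theorem isEvaluation_zero :
    KasparovModule.IsEvaluation 0 (𝐏).kasparovModule (KasparovModule.zero Cl20 A) := by
  -- At time `0` the generators `(J 0 - J 0) (c 0)` vanish, and vanishing at `0` is a closed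
  -- condition.
  have h0 : ∀ x : (𝐏).X, (x : C(I, A)) 0 = 0 := fun x =>
    (𝐏).induction_X (p := fun f => f 0 = 0) (isClosed_eq (continuous_eval_const (0 : I)) continuous_const)
      (fun c => by
        change (J 0 - J 0 : 𝓜(ℂ, A)).fst (c 0) = 0
        rw [sub_self]
        rfl) x x.2
  -- The zero map is onto the one-point module; the only condition with content is that inner
  -- products vanish at time `0`.
  refine ⟨0, fun _ => ⟨0, rfl⟩, fun x y => ?_, fun _ _ => rfl, fun _ => rfl, fun _ => rfl,
    fun _ _ => rfl, fun _ => rfl⟩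
  change (0 : A) = star ((x.1 : C(I, A)) 0) * (y.1 : C(I, A)) 0 +
    star ((x.2 : C(I, A)) 0) * (y.2 : C(I, A)) 0
  rw [h0 x.1, h0 x.2, star_zero, zero_mul, zero_mul, add_zero]

/-- The class of the Cayley transform vanishes along norm-continuous local paths. -/
theorem cayleyClass_fiber_one : (𝐅 1).cayleyClass = 0 :=
  (Quot.sound ⟨_, isEvaluation_zero htriv J hJ hloc, isEvaluation_fiber htriv J hJ hloc 1⟩).symm

end LocalPair

theorem mainTheorem11 {A : Type u} [NonUnitalCStarAlgebra A] [GradedRealCStarAlgebra A]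
    (htriv : TriviallyGraded A) (hσ : SigmaUnital A) :
    (∀ (J : C(I, 𝓜(ℂ, A))) (hJ : ∀ t, IsRealSkewUnitary (J t))
        (hloc : ∀ t, J t - J 0 ∈ Set.range (DoubleCentralizer.coe ℂ : A → 𝓜(ℂ, A))),
        (LocalPair.mk htriv (J 0) (J 1) (hJ 0) (hJ 1) (hloc 1)).cayleyClass = 0) ∧
    (∀ P : LocalPair A, P.cayleyClass ≠ 0 →
        ¬ ∃ J : C(I, 𝓜(ℂ, A)), J 0 = P.J₀ ∧ J 1 = P.J₁ ∧ (∀ t, IsRealSkewUnitary (J t)) ∧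
          ∀ t, J t - J 0 ∈ Set.range (DoubleCentralizer.coe ℂ : A → 𝓜(ℂ, A))) := by
  have h := fun J hJ hloc => LocalPair.cayleyClass_fiber_one htriv J hJ hloc
  refine ⟨h, ?_⟩
  -- Substituting the endpoints turns the given pair into the one attached to the path, up to proofs
  -- of propositions, so the first part contradicts `hP`.
  rintro ⟨htriv, J₀, J₁, h₀, h₁, hsub⟩ hP ⟨J, rfl, rfl, hJ, hloc⟩
  exact hP (h J hJ hloc)
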